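/- Notation. For $r>0$ let $Q_r=([-r,r]\cap\mathbb Z)^3$. For $u:\mathbb Z^3\to\mathbb R$ let $\Delta u(a)=-6u(a)+\sum_{b\in\mathbb Z^3,\,|b-a|=1}u(b)$. For nonempty $A,B\subset\mathbb R^3$ let $\operatorname{dist}(A,B)=\inf_{a\in A,\,b\in B}|a-b|$ and $\operatorname{diam}A=\sup_{a,b\in A}|a-b|$ (Euclidean norm). Let $d\ge 0$ and $N\ge 1$ be integers, let $C,\varepsilon>0$, and let $\vec l=(l_1,\dots,l_d)$ be a vector of reals. An $(N,\vec l,C,\varepsilon)$-graded set is a set $E\subset\mathbb R^3$ together with a decomposition $E=E_0\cup E_1\cup\dots\cup E_d$ such that 1. $l_i>1$ for $1\le i\le d$, and $l_{i-1}^{1+2\varepsilon}\le l_i$ for $2\le i\le d$; 2. $E_0=\bigcup_{j\in\mathbb Z_+}Z^{(j)}$, where every $Z^{(j)}$ is an open unit ball with centre in $\mathbb Z^3$ and $\operatorname{dist}(Z^{(j)},Z^{(j')})\ge C$ for $j\ne j'$; 3. for $1\le i\le d$, $E_i=\bigcup_{j\in\mathbb Z_+,\,1\le t\le N}Z_i^{(j,t)}$,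 where every $Z_i^{(j,t)}$ is an open ball of radius $l_i$ in $\mathbb R^3$ and $\operatorname{dist}(Z_i^{(j,t)},Z_i^{(j',t)})\ge l_i^{1+\varepsilon}$ for all $t$ and all $j\neq j'$. Such a set is called $(\overline C,\overline\varepsilon)$-normal in a bounded set $A\subset\mathbb R^3$ if $E_0\cap A\ne\emptyset$ implies $\overline C\le\operatorname{diam}A$, and, for each $1\le i\le d$, $E_i\cap A\neq\emptyset$ implies $l_i\le(\operatorname{diam}A)^{1-\overline\varepsilon/2}$. Theorem. There are universal constants $C_3>0$ and $\varepsilon_0>0$, a constant $C_2>0$ depending only on $K$, and a constant $C_{\varepsilon,N}>0$ depending only on $\varepsilon$ and $N$, such that the following holds for all $K>0$, all integers $N\ge1$ and all $0<\varepsilon<\varepsilon_0$. Let $n>C_{\varepsilon,N}$ be an integer and let $u,V:\mathbb Z^3\to\mathbb R$ satisfy $\Delta u(a)=V(a)u(a)$ and $|V(a)|\le K$ for all $a\in Q_n$. Let $E\subset\mathbb R^3$ be an $(N,\vec l,\varepsilon^{-1},\varepsilon)$-graded set with $l_1>C_{\varepsilon,N}$ (no condition if $d=0$) that is $(1,2\varepsilon)$-normal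 in $Q_n$. Then $$\bigl|\{a\in Q_n: |u(a)|\ge \exp(-C_2n^3)\,|u(\mathbf 0)|\}\setminus E\bigr|\ \ge\ C_3\,\frac{n^2}{\log_2 n}.$$ -/

import Mathlib

namespace DiscreteUCP

/-- The lattice `ℤ³`. -/
abbrev Z3 : Type := Fin 3 → ℤ

/-- The space `ℝ³` with its Euclidean norm. -/
abbrev R3 : Type := EuclideanSpace ℝ (Fin 3)

/-- The inclusion `ℤ³ ⊂ ℝ³`. -/
noncomputable def toR3 (a : Z3) : R3 := WithLp.toLp 2 (fun i => (a i : ℝ))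

/-- The discrete Laplacian on `ℤ³`: the sum of `u` over the six lattice neighbours of `a`,
minus `6 u(a)`. -/
def laplacian (u : Z3 → ℝ) (a : Z3) : ℝ :=
  -6 * u a + ∑ i : Fin 3, (u (a + Pi.single i 1) + u (a - Pi.single i 1))

/-- The cube `Q_r(a) = a + ([-r, r] ∩ ℤ)³`. -/
def cube (r : ℝ) (a : Z3) : Set Z3 := {b | ∀ i, |(b i : ℝ) - (a i : ℝ)| ≤ r}

/-- The distance `inf {|a - b| : a ∈ A, b ∈ B}` between two (nonempty) subsets of `ℝ³`. -/
noncomputable def setDist (A B : Set R3) : ℝ :=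
  sInf {r : ℝ | ∃ a ∈ A, ∃ b ∈ B, r = dist a b}

/-- `Z` is `(N, l, ε)`-scattered: a union of open balls of radius `l`, arranged in `N` sequences,
such that any two balls with different indices in the same sequence are at distance at least
`l ^ (1 + ε)`. -/
def IsScattered (N : ℕ) (l ε : ℝ) (Z : Set R3) : Prop :=
  ∃ c : ℕ → Fin N → R3,
    Z = (⋃ j, ⋃ t, Metric.ball (c j t) l) ∧
    ∀ t : Fin N, ∀ j j' : ℕ, j ≠ j' →
      l ^ (1 + ε) ≤ setDist (Metric.ball (c j t) l) (Metric.ball (c j' t) l)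

/-- `Z` is `C`-unitscattered: a union of a sequence of open unit balls with centres in `ℤ³`, any
two of which (with different indices) are at distance at least `C`. -/
def IsUnitScattered (C : ℝ) (Z : Set R3) : Prop :=
  ∃ c : ℕ → Z3,
    Z = (⋃ j, Metric.ball (toR3 (c j)) 1) ∧
    ∀ j j' : ℕ, j ≠ j' →
      C ≤ setDist (Metric.ball (toR3 (c j)) 1) (Metric.ball (toR3 (c j')) 1)

/-- The vector `(l₁, …, l_d)`, stored as `l 0, …, l (d - 1)`, is `ε`-geometric. -/
def IsGeometric {d : ℕ} (ε : ℝ) (l : Fin d → ℝ) : Prop :=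
  (∀ i, 1 < l i) ∧
  ∀ i j : Fin d, (i : ℕ) + 1 = (j : ℕ) → (l i) ^ (1 + 2 * ε) ≤ l j

/-- `E` is an `(N, l, C, ε)`-graded set with the decomposition `E = E₀ ∪ E₁ ∪ ⋯ ∪ E_d`; here
`E₀` is the unit-scattered part, and the scattered part with scale length `l i` is `F i`. -/
structure IsGraded (N : ℕ) {d : ℕ} (l : Fin d → ℝ) (C ε : ℝ)
    (E E₀ : Set R3) (F : Fin d → Set R3) : Prop where
  eq_union : E = E₀ ∪ ⋃ i, F i
  geometric : IsGeometric ε l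
  unitScattered : IsUnitScattered C E₀
  scattered : ∀ i, IsScattered N (l i) ε (F i)

/-- The graded set with parts `E₀`, `F i` and scale lengths `l i` is `(C', ε')`-normal in the
bounded set `A`. -/
def IsNormalIn {d : ℕ} (l : Fin d → ℝ) (E₀ : Set R3) (F : Fin d → Set R3)
    (C' ε' : ℝ) (A : Set R3) : Prop :=
  ((E₀ ∩ A).Nonempty → C' ≤ Metric.diam A) ∧
  ∀ i, (F i ∩ A).Nonempty → l i ≤ Metric.diam A ^ (1 - ε' / 2)

end DiscreteUCP

namespace DiscreteUCP
open Finset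

/-! Call a point exceptional if it lies outside the graded set and carries a value of `u` at or
above the threshold. If the cube had fewer than a small multiple of n² exceptional points, smallness
would spread to the origin with total loss exp(C n³), which is a contradiction. The bound reached is
a multiple of n²; the logarithm is given away at the end.

Planar engine. When `u` is small on the two preceding planes ∑ xᵢ = const, the equation says that on
the next plane the sum of `u` over each elementary triangle is small. After an alternating sign,
each lattice row is then nearly a discrete primitive of the previous row. The first large row beyond
a small region is nearly constant, so the k-th row after it is nearly a polynomial of degree k with
large leading coefficient, and such a polynomial is small at no more than k integers
(`rows_dichotomy`). Hence smallness on a triangle expands across each side up to a margin whose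
every row costs about half a side length of exceptional points (`expand_triangle`). A Vitali
covering (`card_le_of_dense_boxes`) finds a starting point near which exceptional points are rare at
all scales, and doubling the scale gives smallness on a triangle of side L up to a margin of order
#X / L, with loss exp(O(L²)) (`small_on_triangle`).

Three dimensions. Smallness on a cube passes, by the equation alone, to a rhombic dodecahedron. This
contains the bases of tetrahedra reaching outside the cube. A tetrahedron is swept plane by plane;
an exceptional point lies in a single plane, so the margins add up to order #X / r
(`small_in_tetrahedron`). With fewer than c r² exceptional points a cube of radius r therefore grows
by a tenth, with loss exp(O(r³)) (`grow_box`). A second covering finds a centre from which cubes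
grow until they contain the origin (`abs_zero_le_of_few_large`).

Graded set. It enters only through its density along lattice segments. Balls of radius l are
enlarged to radii of order l^(1+ε/2) and l^(1+3ε/4), still far below the separation l^(1+ε). Outside
an enlargement, only balls small enough for the current scale are met; at each level the density is
of order l^(-ε/4), which is summable over the scales. -/

/-! ### Polynomials small at many integers, and rows of iterated primitives. -/

theorem factorial_card_le_prod (D : Finset ℕ) (hD : ∀ d ∈ D, 0 < d) :
    (D.card).factorial ≤ ∏ d ∈ D, d := by
  induction D using Finset.induction_on_max with
  | empty => simp
  | insert a s ha ih =>
    have hn : a ∉ s := fun h => lt_irrefl _ (ha a h)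
    rw [card_insert_of_notMem hn, prod_insert hn, Nat.factorial_succ]
    refine Nat.mul_le_mul ?_ (ih fun d hd => hD d (mem_insert_of_mem hd))
    have hsub : insert a s ⊆ Icc 1 a := by
      intro y hy
      rw [mem_Icc]
      refine ⟨hD y hy, ?_⟩
      rcases mem_insert.1 hy with h | h
      · exact h.le
      · exact (ha y h).le
    have := card_le_card hsub
    rw [card_insert_of_notMem hn] at this
    simpa using this

/-- With a points of `X` below `x` and b above, the distances on each side are distinct positive
integers, so the product is at least a! b! = k! / C(k, a). This bounds the Lagrange denominators
from below. -/
theorem factorial_le_two_pow_mul_prod_sub (X : Finset ℕ) (x : ℕ) (hx : x ∈ X) (k : ℕ)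
    (hX : X.card = k + 1) :
    (k.factorial : ℝ) ≤ 2 ^ k * |∏ y ∈ X.erase x, ((x : ℝ) - y)| := by
  have hlow : (((X.filter (· < x)).card).factorial : ℝ) ≤
      ∏ y ∈ X.filter (· < x), |(x : ℝ) - y| := by
    have h := factorial_card_le_prod ((X.filter (· < x)).image (fun y => x - y)) (by
      intro d hd
      obtain ⟨y, hy, rfl⟩ := mem_image.1 hd
      have := (mem_filter.1 hy).2
      lia)
    have hinj : Set.InjOn (fun y => x - y) (X.filter (· < x) : Set ℕ) := by
      intro y hy z hz hyz
      have h1 := (mem_filter.1 hy).2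
      have h2 := (mem_filter.1 hz).2
      simp only at hyz
      lia
    rw [card_image_of_injOn hinj, prod_image hinj] at h
    have h' : (((X.filter (· < x)).card).factorial : ℝ) ≤
      ((∏ y ∈ X.filter (· < x), (x - y) : ℕ) : ℝ) := by exact_mod_cast h
    refine h'.trans (le_of_eq ?_)
    rw [Nat.cast_prod]
    refine prod_congr rfl fun y hy => ?_
    have h1 := (mem_filter.1 hy).2
    rw [Nat.cast_sub h1.le, abs_of_nonneg]
    have : (y : ℝ) < x := by exact_mod_cast h1
    linarith
  have hhigh : (((X.filter (x < ·)).card).factorial : ℝ) ≤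
      ∏ y ∈ X.filter (x < ·), |(x : ℝ) - y| := by
    have h := factorial_card_le_prod ((X.filter (x < ·)).image (fun y => y - x)) (by
      intro d hd
      obtain ⟨y, hy, rfl⟩ := mem_image.1 hd
      have := (mem_filter.1 hy).2
      lia)
    have hinj : Set.InjOn (fun y => y - x) (X.filter (x < ·) : Set ℕ) := by
      intro y hy z hz hyz
      have h1 := (mem_filter.1 hy).2
      have h2 := (mem_filter.1 hz).2
      simp only at hyz
      lia
    rw [card_image_of_injOn hinj, prod_image hinj] at h
    have h' : (((X.filter (x < ·)).card).factorial : ℝ) ≤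
      ((∏ y ∈ X.filter (x < ·), (y - x) : ℕ) : ℝ) := by exact_mod_cast h
    refine h'.trans (le_of_eq ?_)
    rw [Nat.cast_prod]
    refine prod_congr rfl fun y hy => ?_
    have h1 := (mem_filter.1 hy).2
    rw [Nat.cast_sub h1.le, abs_sub_comm, abs_of_nonneg]
    have : (x : ℝ) < y := by exact_mod_cast h1
    linarith
  have hsplit : X.erase x = X.filter (· < x) ∪ X.filter (x < ·) := by
    ext y
    simp only [mem_erase, mem_union, mem_filter]
    constructor
    · rintro ⟨h1, h2⟩
      rcases lt_or_gt_of_ne h1 with h | h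
      · exact Or.inl ⟨h2, h⟩
      · exact Or.inr ⟨h2, h⟩
    · rintro (⟨h1, h2⟩ | ⟨h1, h2⟩)
      · exact ⟨h2.ne, h1⟩
      · exact ⟨h2.ne', h1⟩
  have hdisj : Disjoint (X.filter (· < x)) (X.filter (x < ·)) := by
    rw [disjoint_left]
    intro y h1 h2
    have h1 := (mem_filter.1 h1).2
    have h2 := (mem_filter.1 h2).2
    lia
  have hk : (X.filter (· < x)).card + (X.filter (x < ·)).card = k := by
    rw [← card_union_of_disjoint hdisj, ← hsplit, card_erase_of_mem hx, hX]
    rfl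
  rw [abs_prod, hsplit, prod_union hdisj]
  set a := (X.filter (· < x)).card
  set b := (X.filter (x < ·)).card
  have hch : (k.factorial : ℝ) = (k.choose a : ℝ) * ((a.factorial : ℝ) * b.factorial) := by
    rw [← hk]
    have := Nat.add_choose_mul_factorial_mul_factorial a b
    rw [← mul_assoc, Nat.choose_symm_add]
    exact_mod_cast this.symm
  rw [hch]
  have h2 : (k.choose a : ℝ) ≤ 2 ^ k := by exact_mod_cast Nat.choose_le_two_pow k a
  gcongr

/-- The sum is a polynomial in x of degree at most k whose x^k coefficient is c 0 / k!. Lagrange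
interpolation on `X` writes it as k + 1 values over denominators at least k! / 2^k, and k + 1 ≤ 2^k.
The spread of `X` plays no role. -/
theorem leading_coeff_le (c : ℕ → ℝ) (k : ℕ) (X : Finset ℕ) (hX : X.card = k + 1) (δ : ℝ)
    (h : ∀ x ∈ X, |∑ t ∈ range (k + 1), c t * (x.choose (k - t) : ℝ)| ≤ δ) :
    |c 0| ≤ 4 ^ k * δ := by
  classical
  let P : Polynomial ℝ := ∑ t ∈ range (k + 1),
    Polynomial.C (c t / ((k - t).factorial : ℝ)) * descPochhammer ℝ (k - t)
  have heval : ∀ x : ℕ, P.eval (x : ℝ) = ∑ t ∈ range (k + 1), c t * (x.choose (k - t) : ℝ) := by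
    intro x
    simp only [P, Polynomial.eval_finsetSum, Polynomial.eval_mul, Polynomial.eval_C,
      descPochhammer_eval_eq_descFactorial]
    refine sum_congr rfl fun t _ => ?_
    rw [Nat.descFactorial_eq_factorial_mul_choose]
    push_cast
    have : ((k - t).factorial : ℝ) ≠ 0 := by positivity
    field_simp
  have hdeg : ∀ t, (Polynomial.C (c t / ((k - t).factorial : ℝ)) *
      descPochhammer ℝ (k - t)).natDegree ≤ k - t := fun t =>
    (Polynomial.natDegree_C_mul_le _ _).trans (descPochhammer_natDegree ℝ _).le
  have hcoeff : P.coeff k = c 0 / (k.factorial : ℝ) := by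
    simp only [P, Polynomial.finsetSum_coeff]
    rw [sum_range_succ', sum_eq_zero]
    · have hm : (descPochhammer ℝ k).coeff k = 1 := by
        have := (monic_descPochhammer ℝ k).coeff_natDegree
        rwa [descPochhammer_natDegree] at this
      simp [hm]
    · intro t ht
      refine Polynomial.coeff_eq_zero_of_natDegree_lt (lt_of_le_of_lt (hdeg _) ?_)
      rw [mem_range] at ht
      lia
  have hPdeg : P.degree < X.card := by
    rw [hX]
    refine (Polynomial.degree_le_natDegree).trans_lt ?_
    have : P.natDegree ≤ k :=
      Polynomial.natDegree_sum_le_of_forall_le _ _ fun t _ => (hdeg t).trans (Nat.sub_le _ _)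
    exact_mod_cast Nat.lt_succ_of_le this
  have key := Lagrange.coeff_eq_sum (s := X) (v := fun n : ℕ => (n : ℝ))
    (fun a _ b _ hab => by simpa using hab) (P := P) hPdeg
  rw [hX, Nat.add_sub_cancel, hcoeff] at key
  have hk0 : (0 : ℝ) < k.factorial := by positivity
  have hδ : 0 ≤ δ := by
    obtain ⟨x, hx⟩ : X.Nonempty := card_pos.1 (by lia)
    exact (abs_nonneg _).trans (h x hx)
  have hterm : ∀ x ∈ X, |P.eval (x : ℝ) / ∏ j ∈ X.erase x, ((x : ℝ) - j)| ≤
      δ * 2 ^ k / k.factorial := by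
    intro x hx
    have h1 := factorial_le_two_pow_mul_prod_sub X x hx k hX
    have h2 := h x hx
    rw [← heval] at h2
    rw [abs_div]
    have hpos : 0 < |∏ y ∈ X.erase x, ((x : ℝ) - y)| := by
      by_contra hcon
      push Not at hcon
      have : (2 : ℝ) ^ k * |∏ y ∈ X.erase x, ((x : ℝ) - y)| ≤ 0 :=
        mul_nonpos_of_nonneg_of_nonpos (by positivity) hcon
      linarith
    rw [div_le_div_iff₀ hpos hk0]
    calc |P.eval (x : ℝ)| * k.factorial
        ≤ δ * (2 ^ k * |∏ y ∈ X.erase x, ((x : ℝ) - y)|) := by gcongr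
      _ = _ := by ring
  have hfin : |c 0 / (k.factorial : ℝ)| ≤ (k + 1) * (δ * 2 ^ k / k.factorial) := by
    rw [key]
    refine (abs_sum_le_sum_abs _ _).trans ((sum_le_sum hterm).trans (le_of_eq ?_))
    rw [sum_const, hX, nsmul_eq_mul]
    push_cast
    ring
  rw [abs_div, abs_of_pos hk0, div_le_iff₀ hk0] at hfin
  have hk2 : ((k : ℝ) + 1) ≤ 2 ^ k := by exact_mod_cast Nat.succ_le_of_lt k.lt_two_pow_self
  calc |c 0| ≤ (k + 1) * (δ * 2 ^ k / k.factorial) * k.factorial := hfin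
    _ = (k + 1) * (δ * 2 ^ k) := by field_simp
    _ ≤ 2 ^ k * (δ * 2 ^ k) := by gcongr
    _ = 4 ^ k * δ := by
      rw [show (4 : ℝ) = 2 * 2 by norm_num, mul_pow]
      ring

/-- By Pascal's rule the comparison polynomials satisfy the recurrence exactly. The deviation at x +
1 is thus at most the sum of two deviations at x plus τ, and (e + τ) 2^x - τ solves y ↦ 2y + τ. -/
theorem rows_near_polynomial (G : ℕ → ℕ → ℝ) (L k : ℕ) (c e τ : ℝ) (he : 0 ≤ e) (hτ : 0 ≤ τ)
    (h0 : ∀ x ≤ L, |G 0 x - c| ≤ e)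
    (hrec : ∀ i < k, ∀ x ≤ L + i, |G (i + 1) (x + 1) - G (i + 1) x - G i x| ≤ τ) :
    ∀ i ≤ k, ∀ x ≤ L + i,
      |G i x - ∑ t ∈ range (i + 1), (if t = 0 then c else G t 0) * (x.choose (i - t) : ℝ)| ≤
        (e + τ) * 2 ^ x - τ := by
  intro i
  induction i with
  | zero =>
    intro hk x hx
    have h1 : (1 : ℝ) ≤ 2 ^ x := one_le_pow₀ (by norm_num)
    have := h0 x hx
    simp only [zero_add, range_one, sum_singleton, if_true, Nat.sub_self, Nat.choose_zero_right,
      Nat.cast_one, mul_one]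
    nlinarith
  | succ i ih =>
    intro hk x
    induction x with
    | zero =>
      intro _
      rw [sum_range_succ, sum_eq_zero]
      · simpa using he
      · intro t ht
        rw [mem_range] at ht
        rw [Nat.choose_eq_zero_of_lt (by lia)]
        simp
    | succ x ihx =>
      intro hx
      have h1 := ihx (by lia)
      have h2 := ih (by lia) x (by lia)
      have h3 := hrec i (by lia) x (by lia)
      set c' : ℕ → ℝ := fun t => if t = 0 then c else G t 0 with hc'
      have hp : ∑ t ∈ range (i + 1 + 1), c' t * ((x + 1).choose (i + 1 - t) : ℝ) =
          ∑ t ∈ range (i + 1 + 1), c' t * (x.choose (i + 1 - t) : ℝ) +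
          ∑ t ∈ range (i + 1), c' t * (x.choose (i - t) : ℝ) := by
        rw [sum_range_succ, sum_range_succ _ (i + 1)]
        have : ∀ t ∈ range (i + 1), c' t * ((x + 1).choose (i + 1 - t) : ℝ) =
            c' t * (x.choose (i + 1 - t) : ℝ) + c' t * (x.choose (i - t) : ℝ) := by
          intro t ht
          rw [mem_range] at ht
          rw [show i + 1 - t = (i - t) + 1 by lia, Nat.choose_succ_succ']
          push_cast
          ring
        rw [sum_congr rfl this, sum_add_distrib]
        simp
        ring
      change |G (i + 1) (x + 1) - ∑ t ∈ range (i + 1 + 1), c' t * ((x + 1).choose (i + 1 - t) : ℝ)| ≤ _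
      rw [hp]
      have e1 : (e + τ) * 2 ^ (x + 1) - τ = ((e + τ) * 2 ^ x - τ) + ((e + τ) * 2 ^ x - τ) + τ := by
        ring
      rw [e1]
      rw [abs_le] at h1 h2 h3 ⊢
      constructor <;> linarith [h1.1, h1.2, h2.1, h2.2, h3.1, h3.2]

theorem rows_leading_le (G : ℕ → ℕ → ℝ) (L k : ℕ) (c e τ δ : ℝ) (he : 0 ≤ e) (hτ : 0 ≤ τ)
    (h0 : ∀ x ≤ L, |G 0 x - c| ≤ e)
    (hrec : ∀ i < k, ∀ x ≤ L + i, |G (i + 1) (x + 1) - G (i + 1) x - G i x| ≤ τ)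
    (hcard : k + 1 ≤ #{x ∈ range (L + k + 1) | |G k x| ≤ δ}) :
    |c| ≤ 4 ^ k * (δ + (e + τ) * 2 ^ (L + k)) := by
  obtain ⟨X, hXs, hX⟩ := exists_subset_card_eq hcard
  have h := leading_coeff_le (fun t => if t = 0 then c else G t 0) k X hX
    (δ + (e + τ) * 2 ^ (L + k)) ?_
  · simpa using h
  · intro x hx
    obtain ⟨hx1, hx2⟩ := mem_filter.1 (hXs hx)
    rw [mem_range] at hx1
    have h3 := rows_near_polynomial G L k c e τ he hτ h0 hrec k le_rfl x (by lia)
    have h4 : (2 : ℝ) ^ x ≤ 2 ^ (L + k) := pow_le_pow_right₀ (by norm_num) (by lia)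
    have h5 : (e + τ) * 2 ^ x ≤ (e + τ) * 2 ^ (L + k) := by gcongr
    rw [abs_le] at h3 hx2 ⊢
    constructor <;> linarith [h3.1, h3.2, hx2.1, hx2.2]

/-- Consecutive rows `F 0, F 1, …`, each of which is nearly a primitive of the previous one:
either the smallness of row `0` propagates, or, from the first large row on, the `k`-th further
row has at most `k` small entries. -/
theorem rows_dichotomy (F : ℕ → ℕ → ℝ) (L h : ℕ) (A τ : ℝ) (hτ : 0 ≤ τ) (hA : τ ≤ A)
    (h0 : ∀ x ≤ L, |F 0 x| ≤ A)
    (hrec : ∀ i < h, ∀ x ≤ L + i, |F (i + 1) (x + 1) - F (i + 1) x - F i x| ≤ τ) :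
    ∃ m ≤ h, (∀ i ≤ m, ∀ x ≤ L + i, |F i x| ≤ A * (2 ^ (8 * (L + h + 1))) ^ i) ∧
      ∀ k, m + 1 + k ≤ h → #{x ∈ range (L + (m + 1 + k) + 1) | |F (m + 1 + k) x| ≤ A} ≤ k := by
  classical
  by_cases hall : ∀ i ≤ h, ∀ x ≤ L + i, |F i x| ≤ A * (2 ^ (8 * (L + h + 1))) ^ i
  · exact ⟨h, le_rfl, hall, fun k hk => by lia⟩
  have hex : ∃ i, i ≤ h ∧ ∃ x ≤ L + i, A * (2 ^ (8 * (L + h + 1))) ^ i < |F i x| := by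
    push Not at hall
    obtain ⟨i, hi, x, hx, hx2⟩ := hall
    exact ⟨i, hi, x, hx, hx2⟩
  obtain ⟨hih, x, hx, hbig⟩ := Nat.find_spec hex
  have hmin : ∀ j < Nat.find hex, ∀ x ≤ L + j, |F j x| ≤ A * (2 ^ (8 * (L + h + 1))) ^ j := by
    intro j hj y hy
    by_contra hcon
    push Not at hcon
    exact Nat.find_min hex hj ⟨by lia, y, hy, hcon⟩
  generalize hi0 : Nat.find hex = i at *
  -- The first row violating the bound is not row 0, so it has a small predecessor `m`.
  rcases i with _ | m
  · exact absurd (h0 x hx) (by simpa using hbig)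
  refine ⟨m, by lia, fun i hi => hmin i (by lia), fun k hk => ?_⟩
  by_contra hcon
  push Not at hcon
  set M := L + h + 1 with hM
  set Am := A * (2 ^ (8 * M)) ^ m with hAm
  have hA0 : 0 ≤ A := hτ.trans hA
  have hAAm : A ≤ Am := le_mul_of_one_le_right hA0 (one_le_pow₀ (one_le_pow₀ (by norm_num)))
  -- Row `m` is small, so row `m + 1` is nearly constant and can serve as row 0 of
  -- `rows_leading_le`. If a later row had too many small entries, that constant would be small,
  -- against the choice of `m`.
  have hrow : ∀ x ≤ L + (m + 1), |F (m + 1) x - F (m + 1) 0| ≤ x * (2 * Am) := by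
    intro x
    induction x with
    | zero => intro _; simp
    | succ x ih =>
      intro hx
      have h1 := ih (by lia)
      have h2 := hrec m (by lia) x (by lia)
      have h3 := hmin m (by lia) x (by lia)
      push_cast
      rw [abs_le] at h1 h2 h3 ⊢
      constructor <;> linarith [h1.1, h1.2, h2.1, h2.2, h3.1, h3.2]
  have hMpow : (2 : ℝ) * M ≤ 2 ^ M := by
    have : ∀ n : ℕ, 2 * (n + 1) ≤ 2 ^ (n + 1) := by
      intro n
      induction n with
      | zero => simp
      | succ n ih => rw [pow_succ]; lia
    exact_mod_cast this (L + h)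
  set e := 2 ^ M * Am with he
  have hAm0 : 0 ≤ Am := hA0.trans hAAm
  have he0 : 0 ≤ e := by positivity
  have hrow' : ∀ x ≤ L + (m + 1), |F (m + 1) x - F (m + 1) 0| ≤ e := by
    intro x hx
    refine (hrow x hx).trans ?_
    have h1 : (x : ℝ) ≤ M := by exact_mod_cast (by lia : x ≤ M)
    calc (x : ℝ) * (2 * Am) ≤ M * (2 * Am) := by gcongr
      _ = 2 * M * Am := by ring
      _ ≤ e := by rw [he]; gcongr
  have hlead := rows_leading_le (fun i => F (m + 1 + i)) (L + (m + 1)) k (F (m + 1) 0) e τ A he0 hτ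
    (by simpa using hrow') (by
      intro i hi x hx
      exact hrec (m + 1 + i) (by lia) x (by lia)) (by
      have : L + (m + 1) + k + 1 = L + (m + 1 + k) + 1 := by ring
      rw [this]
      exact hcon)
  have h4 : (4 : ℝ) ^ k ≤ 2 ^ M * 2 ^ M := by
    rw [← mul_pow]
    norm_num
    exact pow_le_pow_right₀ (by norm_num) (by lia)
  have h5 : (2 : ℝ) ^ (L + (m + 1) + k) ≤ 2 ^ M := pow_le_pow_right₀ (by norm_num) (by lia)
  have h6 := hrow' x hx
  have hz : (1 : ℝ) ≤ 2 ^ M := one_le_pow₀ (by norm_num)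
  have hz2 : (2 : ℝ) ≤ 2 ^ M := by
    calc (2 : ℝ) = 2 ^ 1 := by norm_num
      _ ≤ 2 ^ M := pow_le_pow_right₀ (by norm_num) (by lia)
  have hlead2 : |F (m + 1) 0| ≤ (2 ^ M * 2 ^ M) * (Am + (e + Am) * 2 ^ M) := by
    refine hlead.trans ?_
    gcongr
    linarith
  have hx3 : |F (m + 1) x| ≤ (2 ^ M * 2 ^ M) * (Am + (e + Am) * 2 ^ M) + e := by
    have := abs_sub_abs_le_abs_sub (F (m + 1) x) (F (m + 1) 0)
    linarith
  -- With z = 2^M the losses total z + z² + z³ + z⁴ ≤ z⁸; this is the source of the exponent 8.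
  have hfin : (2 ^ M * 2 ^ M) * (Am + (e + Am) * 2 ^ M) + e ≤
      A * (2 ^ (8 * M)) ^ (m + 1) := by
    have : A * (2 ^ (8 * M)) ^ (m + 1) = Am * (2 ^ M) ^ 8 := by
      rw [hAm, pow_succ, ← pow_mul 2 M 8, mul_comm M 8]
      ring
    rw [this, he]
    generalize (2 : ℝ) ^ M = z at *
    have hz4 : 4 * z ^ 4 ≤ z ^ 8 := by
      have h7 : 4 ≤ z ^ 4 := by
        have : (2 : ℝ) ^ 4 ≤ z ^ 4 := by gcongr
        linarith
      calc 4 * z ^ 4 ≤ z ^ 4 * z ^ 4 := by gcongr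
        _ = z ^ 8 := by ring
    have a1 : z ^ 1 ≤ z ^ 4 := pow_le_pow_right₀ hz (by norm_num)
    have a2 : z ^ 2 ≤ z ^ 4 := pow_le_pow_right₀ hz (by norm_num)
    have a3 : z ^ 3 ≤ z ^ 4 := pow_le_pow_right₀ hz (by norm_num)
    have : z + z ^ 2 + z ^ 3 + z ^ 4 ≤ z ^ 8 := by linarith
    calc z * z * (Am + (z * Am + Am) * z) + z * Am = Am * (z + z ^ 2 + z ^ 3 + z ^ 4) := by ring
      _ ≤ Am * z ^ 8 := by gcongr
  linarith

/-! ### Lattice triangles and expansion of smallness across their sides. -/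

/-- The lattice triangle `{x : x i ≥ α i, ∑ x i = s}`. -/
def tri (α : Z3) (s : ℤ) : Set Z3 := {x | (∀ i, α i ≤ x i) ∧ ∑ i, x i = s}

/-- On the triangle `tri α s`, the sum of `u` over each elementary upward triangle is at most
`τ` in absolute value. -/
def TriRel (u : Z3 → ℝ) (τ : ℝ) (α : Z3) (s : ℤ) : Prop :=
  ∀ b ∈ tri α (s - 1), |∑ i, u (b + Pi.single i 1)| ≤ τ

/-- The point with coordinates `a`, `b`, `c` in the cyclic order starting from `i`. -/
def cyc (i : Fin 3) (a b c : ℤ) : Z3 := fun t => if t = i then a else if t = i + 1 then b else c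

theorem fin3_ne (i : Fin 3) : i + 1 ≠ i ∧ i + 2 ≠ i ∧ i + 2 ≠ i + 1 := by
  revert i; decide

theorem fin3_cases (i t : Fin 3) : t = i ∨ t = i + 1 ∨ t = i + 2 := by
  revert i t; decide

theorem sum_fin3 {G : Type*} [AddCommMonoid G] (f : Fin 3 → G) (i : Fin 3) :
    ∑ t, f t = f i + f (i + 1) + f (i + 2) := by
  rw [Fin.sum_univ_three]
  fin_cases i
  · rfl
  · change f 0 + f 1 + f 2 = f 1 + f 2 + f 0
    abel
  · change f 0 + f 1 + f 2 = f 2 + f 0 + f 1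
    abel

@[simp] theorem cyc_zero (i : Fin 3) (a b c : ℤ) : cyc i a b c i = a := by simp [cyc]
@[simp] theorem cyc_one (i : Fin 3) (a b c : ℤ) : cyc i a b c (i + 1) = b := by
  simp [cyc]
@[simp] theorem cyc_two (i : Fin 3) (a b c : ℤ) : cyc i a b c (i + 2) = c := by
  have := fin3_ne i
  simp [cyc, this.2.1, this.2.2]

theorem eq_cyc (i : Fin 3) (x : Z3) : x = cyc i (x i) (x (i + 1)) (x (i + 2)) := by
  funext t
  rcases fin3_cases i t with rfl | rfl | rfl
  · rw [cyc_zero]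
  · rw [cyc_one]
  · rw [cyc_two]

theorem cyc_add_single (i : Fin 3) (a b c : ℤ) :
    cyc i a b c + Pi.single i 1 = cyc i (a + 1) b c ∧
    cyc i a b c + Pi.single (i + 1) 1 = cyc i a (b + 1) c ∧
    cyc i a b c + Pi.single (i + 2) 1 = cyc i a b (c + 1) := by
  obtain ⟨h1, h2, h3⟩ := fin3_ne i
  refine ⟨?_, ?_, ?_⟩ <;> rw [eq_cyc i (cyc i a b c + _)] <;>
    simp [h1, h2, h3, h1.symm, h2.symm, h3.symm]

theorem cyc_mem_tri (i : Fin 3) (a b c : ℤ) (α : Z3) (s : ℤ) :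
    cyc i a b c ∈ tri α s ↔ (α i ≤ a ∧ α (i + 1) ≤ b ∧ α (i + 2) ≤ c) ∧ a + b + c = s := by
  rw [tri, Set.mem_ofPred_eq, sum_fin3 _ i]
  simp only [cyc_zero, cyc_one, cyc_two]
  refine and_congr_left fun _ => ⟨fun h => ?_, fun h t => ?_⟩
  · have h0 := h i
    have h1 := h (i + 1)
    have h2 := h (i + 2)
    simp only [cyc_zero, cyc_one, cyc_two] at h0 h1 h2
    exact ⟨h0, h1, h2⟩
  · rcases fin3_cases i t with rfl | rfl | rfl
    · simpa using h.1
    · simpa using h.2.1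
    · simpa using h.2.2

/-- The `x`-th point of the `k`-th row outside the side `i` of the triangle with lower corner `β`
and side length `L`. -/
def rowPt (i : Fin 3) (β : Z3) (L k x : ℕ) : Z3 :=
  cyc i (β i - k) (β (i + 1) + x) (β (i + 2) + (L + k - x))

theorem rowPt_mem (i : Fin 3) (β : Z3) (L h k x : ℕ) (hk : k ≤ h) (hx : x ≤ L + k) :
    rowPt i β L k x ∈ tri (β - Pi.single i (h : ℤ)) (∑ t, β t + L) := by
  obtain ⟨h1, h2, h3⟩ := fin3_ne i
  rw [rowPt, cyc_mem_tri, sum_fin3 _ i]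
  simp [h1, h2]
  constructor
  · lia
  · ring

open Classical in
-- The sign (-1)^x turns the three-term relation into the primitive relation of `rows_dichotomy`.
-- Row m + 1 + k has L + m + k + 2 points, of which at most k are small and at most L / 4 lie in
-- `E`; so at least L / 2 lie in `X`. Summing over the h - m failing rows gives the count.
theorem expand_side (u : Z3 → ℝ) (E : Set Z3) (X : Finset Z3) (i : Fin 3) (β : Z3) (L h : ℕ)
    (A τ : ℝ) (hτ : 0 ≤ τ) (hA : τ ≤ A)
    (hs : ∀ x ∈ tri β (∑ t, β t + L), |u x| ≤ A)
    (hrel : TriRel u τ (β - Pi.single i (h : ℤ)) (∑ t, β t + L))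
    (hsm : ∀ x ∈ tri (β - Pi.single i (h : ℤ)) (∑ t, β t + L), |u x| ≤ A ∨ x ∈ E ∨ x ∈ X)
    (hE : ∀ k ≤ h, 4 * #{x ∈ range (L + k + 1) | rowPt i β L k x ∈ E} ≤ L) :
    ∃ m ≤ h, (∀ x ∈ tri (β - Pi.single i (m : ℤ)) (∑ t, β t + L),
      |u x| ≤ A * (2 ^ (8 * (L + h + 1))) ^ m) ∧ (h - m) * L ≤ 2 * #X := by
  obtain ⟨hi1, hi2, hi3⟩ := fin3_ne i
  have hA0 : 0 ≤ A := hτ.trans hA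
  obtain ⟨m, hm, hsmall, hrows⟩ := rows_dichotomy
    (fun k x => (-1) ^ x * u (rowPt i β L k x)) L h A τ hτ hA (by
      intro x hx
      rw [abs_mul, abs_pow, abs_neg, abs_one, one_pow, one_mul]
      refine hs _ ?_
      have := rowPt_mem i β L 0 0 x le_rfl (by simpa using hx)
      simpa using this) (by
      intro k hk x hx
      have h1 := hrel (cyc i (β i - (k + 1 : ℕ)) (β (i + 1) + x) (β (i + 2) + (L + k - x))) (by
        rw [cyc_mem_tri, sum_fin3 _ i]
        simp [hi1, hi2]
        constructor
        · lia
        · ring)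
      rw [sum_fin3 _ i, (cyc_add_single ..).1, (cyc_add_single ..).2.1,
        (cyc_add_single ..).2.2] at h1
      have e1 : rowPt i β L (k + 1) (x + 1) = cyc i (β i - (k + 1 : ℕ)) (β (i + 1) + x + 1)
          (β (i + 2) + (L + k - x)) := by
        rw [rowPt]; push_cast; congr 1 <;> ring
      have e2 : rowPt i β L (k + 1) x = cyc i (β i - (k + 1 : ℕ)) (β (i + 1) + x)
          (β (i + 2) + (L + k - x) + 1) := by
        rw [rowPt]; push_cast; congr 1; ring
      have e3 : rowPt i β L k x = cyc i (β i - (k + 1 : ℕ) + 1) (β (i + 1) + x)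
          (β (i + 2) + (L + k - x)) := by
        rw [rowPt]; push_cast; congr 1; ring
      rw [← e1, ← e2, ← e3] at h1
      have e4 : (-1 : ℝ) ^ (x + 1) * u (rowPt i β L (k + 1) (x + 1)) -
          (-1) ^ x * u (rowPt i β L (k + 1) x) - (-1) ^ x * u (rowPt i β L k x) =
          -((-1) ^ x * (u (rowPt i β L k x) + u (rowPt i β L (k + 1) (x + 1)) +
            u (rowPt i β L (k + 1) x))) := by ring
      rw [e4, abs_neg, abs_mul, abs_pow, abs_neg, abs_one, one_pow, one_mul]
      exact h1)
  have habs : ∀ k x : ℕ, |(-1 : ℝ) ^ x * u (rowPt i β L k x)| = |u (rowPt i β L k x)| := by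
    intro k x
    rw [abs_mul, abs_pow, abs_neg, abs_one, one_pow, one_mul]
  simp only [habs] at hsmall hrows
  refine ⟨m, hm, fun x hx => ?_, ?_⟩
  · by_cases hxi : β i ≤ x i
    · have hxt : x ∈ tri β (∑ t, β t + L) := by
        refine ⟨fun t => ?_, hx.2⟩
        by_cases ht : t = i
        · rw [ht]; exact hxi
        · have := hx.1 t
          simpa [Pi.single_apply, ht] using this
      exact (hs x hxt).trans (le_mul_of_one_le_right hA0 (one_le_pow₀ (one_le_pow₀ (by norm_num))))
    · push Not at hxi
      have h0 := hx.1 i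
      have h1 := hx.1 (i + 1)
      have h2 := hx.1 (i + 2)
      have h3 := hx.2
      rw [sum_fin3 _ i, sum_fin3 _ i] at h3
      simp [hi1, hi2] at h0 h1 h2
      obtain ⟨k, hk⟩ := Int.eq_ofNat_of_zero_le (a := β i - x i) (by lia)
      obtain ⟨y, hy⟩ := Int.eq_ofNat_of_zero_le (a := x (i + 1) - β (i + 1)) (by lia)
      have hxe : x = rowPt i β L k y := by
        rw [rowPt, eq_cyc i x]
        congr 1 <;> lia
      have := hsmall k (by lia) y (by lia)
      rw [← hxe] at this
      refine this.trans ?_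
      gcongr
      · exact one_le_pow₀ (by norm_num)
      · lia
  · have hcard : ∀ k ∈ range (h - m), L ≤
        2 * #{x ∈ range (L + (m + 1 + k) + 1) | rowPt i β L (m + 1 + k) x ∈ X} := by
      intro k hk
      rw [mem_range] at hk
      have h1 := hrows k (by lia)
      have h2 := hE (m + 1 + k) (by lia)
      have h3 : range (L + (m + 1 + k) + 1) ⊆
          ({x ∈ range (L + (m + 1 + k) + 1) | |u (rowPt i β L (m + 1 + k) x)| ≤ A} ∪
          {x ∈ range (L + (m + 1 + k) + 1) | rowPt i β L (m + 1 + k) x ∈ E}) ∪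
          {x ∈ range (L + (m + 1 + k) + 1) | rowPt i β L (m + 1 + k) x ∈ X} := by
        intro x hx
        have hx' := mem_range.1 hx
        simp only [mem_union, mem_filter, hx, true_and]
        have := hsm _ (rowPt_mem i β L h (m + 1 + k) x (by lia) (by lia))
        tauto
      have h4 := (card_le_card h3).trans ((card_union_le _ _).trans
        (Nat.add_le_add_right (card_union_le _ _) _))
      rw [card_range] at h4
      lia
    have hsum : (h - m) * L ≤
        2 * ∑ k ∈ range (h - m),
          #{x ∈ range (L + (m + 1 + k) + 1) | rowPt i β L (m + 1 + k) x ∈ X} := by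
      rw [mul_sum]
      calc (h - m) * L = ∑ k ∈ range (h - m), L := by simp
        _ ≤ _ := sum_le_sum hcard
    refine hsum.trans (Nat.mul_le_mul_left 2 ?_)
    rw [← card_sigma]
    refine card_le_card_of_injOn (fun p => rowPt i β L (m + 1 + p.1) p.2) ?_ ?_
    · rintro ⟨k, x⟩ hp
      simp only [coe_sigma, Set.mem_sigma_iff, mem_coe, mem_filter] at hp
      exact hp.2.2
    · rintro ⟨k, x⟩ _ ⟨k', x'⟩ _ heq
      have a := congrFun heq i
      have b := congrFun heq (i + 1)
      simp only [rowPt, cyc_zero, cyc_one] at a b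
      have : k = k' := by lia
      have : x = x' := by lia
      subst_vars
      rfl

/-- A nonzero lattice vector with coordinates in `{-1, 0, 1}`. -/
def IsStep (v : Z3) : Prop := v ≠ 0 ∧ ∀ i, |v i| ≤ 1

open Classical in
/-- The number of points of the segment `x, x + v, …, x + (n - 1) v` that lie in `E`. -/
noncomputable def segCount (E : Set Z3) (x v : Z3) (n : ℕ) : ℕ :=
  #((range n).filter fun k : ℕ => x + (k : ℤ) • v ∈ E)

theorem rowPt_eq (i : Fin 3) (β : Z3) (L k x : ℕ) :
    rowPt i β L k x = rowPt i β L k 0 + (x : ℤ) • cyc i 0 1 (-1) := by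
  funext t
  rcases fin3_cases i t with rfl | rfl | rfl
  · simp [rowPt]
  · simp [rowPt]
  · simp [rowPt]; ring

theorem isStep_cyc (i : Fin 3) : IsStep (cyc i 0 1 (-1)) := by
  refine ⟨fun h => ?_, fun t => ?_⟩
  · have := congrFun h (i + 1)
    simp at this
  · rcases fin3_cases i t with rfl | rfl | rfl <;> simp

/-- A form of `expand_side` that can be iterated over the sides: the current triangle `γ` may vary,
while the hypothesis on `E` and the growth factor depend only on the initial and final side lengths.
-/
theorem expand_side_of_segCount (u : Z3 → ℝ) (E : Set Z3) (X : Finset Z3) (α β γ : Z3) (s : ℤ)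
    (L' L : ℕ) (hαγ : α ≤ γ) (hγβ : γ ≤ β) (hL' : s = ∑ t, β t + L') (hL : s = ∑ t, α t + L)
    (A τ : ℝ) (hτ : 0 ≤ τ) (hA : τ ≤ A)
    (hs : ∀ x ∈ tri γ s, |u x| ≤ A) (hrel : TriRel u τ α s)
    (hsm : ∀ x ∈ tri α s, |u x| ≤ A ∨ x ∈ E ∨ x ∈ X)
    (hE : ∀ x v : Z3, ∀ n : ℕ, IsStep v → L' ≤ n → n ≤ L + 1 →
      (∀ k < n, x + (k : ℤ) • v ∈ tri α s) → 4 * segCount E x v n ≤ L') (i : Fin 3) :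
    ∃ γ' : Z3, α ≤ γ' ∧ γ' ≤ γ ∧ (γ' i - α i) * L' ≤ 2 * #X ∧
      ∀ x ∈ tri γ' s, |u x| ≤ A * 2 ^ (8 * (L + 1) ^ 2) := by
  classical
  obtain ⟨hi1, hi2, hi3⟩ := fin3_ne i
  have hαβ0 := hαγ i
  have hαβ1 := hαγ (i + 1)
  have hαβ2 := hαγ (i + 2)
  have hg0 := hγβ i
  have hg1 := hγβ (i + 1)
  have hg2 := hγβ (i + 2)
  rw [sum_fin3 _ i] at hL hL'
  obtain ⟨h, hh⟩ := Int.eq_ofNat_of_zero_le (a := γ i - α i) (by lia)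
  obtain ⟨Lγ, hLγ⟩ := Int.eq_ofNat_of_zero_le (a := s - ∑ t, γ t) (by rw [sum_fin3 _ i]; lia)
  have hs' : s = ∑ t, γ t + Lγ := by lia
  have hLγ' := hs'
  rw [sum_fin3 _ i] at hLγ'
  have hsub : ∀ x ∈ tri (γ - Pi.single i (h : ℤ)) s, x ∈ tri α s := by
    intro x hx
    refine ⟨fun t => ?_, hx.2⟩
    have h1 := hx.1 t
    have h2 := hαγ t
    by_cases ht : t = i
    · subst ht
      simp at h1
      lia
    · simp [ht] at h1
      lia
  obtain ⟨m, hm, hsmall, hcard⟩ := expand_side u E X i γ Lγ h A τ hτ hA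
    (by rw [← hs']; exact hs)
    (by
      intro b hb
      refine hrel b ⟨fun t => ?_, by rw [hb.2, ← hs']⟩
      have h1 := hb.1 t
      have h2 := hαγ t
      by_cases ht : t = i
      · subst ht
        simp at h1
        lia
      · simp [ht] at h1
        lia)
    (by
      rw [← hs']
      exact fun x hx => hsm x (hsub x hx))
    (by
      intro k hk
      have h1 := hE (rowPt i γ Lγ k 0) (cyc i 0 1 (-1)) (Lγ + k + 1) (isStep_cyc i) (by lia)
        (by lia) (by
          intro y hy
          rw [← rowPt_eq]
          refine hsub _ ?_
          rw [hs']
          exact rowPt_mem i γ Lγ h k y hk (by lia))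
      rw [segCount] at h1
      have e : ∀ y : ℕ, rowPt i γ Lγ k 0 + (y : ℤ) • cyc i 0 1 (-1) = rowPt i γ Lγ k y :=
        fun y => (rowPt_eq ..).symm
      simp only [e] at h1
      exact h1.trans (by lia))
  rw [← hs'] at hsmall
  refine ⟨γ - Pi.single i (m : ℤ), fun t => ?_, fun t => ?_, ?_, fun x hx => ?_⟩
  · by_cases ht : t = i
    · subst ht
      simp
      lia
    · simpa [ht] using hαγ t
  · by_cases ht : t = i
    · subst ht
      simp
    · simp [ht]
  · have e1 : (γ - Pi.single i (m : ℤ) : Z3) i - α i = ((h - m : ℕ) : ℤ) := by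
      simp
      lia
    rw [e1]
    have : (h - m) * L' ≤ 2 * #X := (Nat.mul_le_mul_left _ (by lia)).trans hcard
    exact_mod_cast this
  · refine (hsmall x hx).trans ?_
    have hA0 : 0 ≤ A := hτ.trans hA
    rw [← pow_mul]
    refine mul_le_mul_of_nonneg_left (pow_le_pow_right₀ (by norm_num) ?_) hA0
    · calc 8 * (Lγ + h + 1) * m ≤ 8 * (L + 1) * (L + 1) := by
            gcongr <;> lia
        _ = 8 * (L + 1) ^ 2 := by ring

/-- Smallness propagates from a triangle to almost all of a larger triangle, up to a margin
controlled by the number of exceptional points. -/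
theorem expand_triangle (u : Z3 → ℝ) (E : Set Z3) (X : Finset Z3) (α β : Z3) (s : ℤ)
    (L' L : ℕ) (hαβ : α ≤ β) (hpos : 0 < L') (hL' : s = ∑ t, β t + L') (hL : s = ∑ t, α t + L)
    (A τ : ℝ) (hτ : 0 ≤ τ) (hA : τ ≤ A)
    (hs : ∀ x ∈ tri β s, |u x| ≤ A) (hrel : TriRel u τ α s)
    (hsm : ∀ x ∈ tri α s, |u x| ≤ A ∨ x ∈ E ∨ x ∈ X)
    (hE : ∀ x v : Z3, ∀ n : ℕ, IsStep v → L' ≤ n → n ≤ L + 1 →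
      (∀ k < n, x + (k : ℤ) • v ∈ tri α s) → 4 * segCount E x v n ≤ L') :
    ∀ x ∈ tri (fun i => α i + (2 * #X / L' : ℕ)) s, |u x| ≤ A * 2 ^ (24 * (L + 1) ^ 2) := by
  have hA0 : 0 ≤ A := hτ.trans hA
  set B : ℝ := 2 ^ (8 * (L + 1) ^ 2) with hB
  have hB1 : 1 ≤ B := one_le_pow₀ (by norm_num)
  -- The sides are treated in turn. Each expansion only lowers the corner, so a margin once reached
  -- at one side persists; three factors of exponent 8 make 24.
  obtain ⟨γ₁, ha₁, hb₁, hc₁, hs₁⟩ := expand_side_of_segCount u E X α β β s L' L hαβ le_rfl hL' hL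
    A τ hτ hA hs hrel hsm hE 0
  have hA1 : A ≤ A * B := le_mul_of_one_le_right hA0 hB1
  have hA2 : A * B ≤ A * B * B := le_mul_of_one_le_right (by positivity) hB1
  obtain ⟨γ₂, ha₂, hb₂, hc₂, hs₂⟩ := expand_side_of_segCount u E X α β γ₁ s L' L ha₁ hb₁ hL' hL
    (A * B) τ hτ (by linarith) hs₁ hrel
    (fun x hx => (hsm x hx).imp_left fun h => h.trans hA1) hE 1
  obtain ⟨γ₃, ha₃, hb₃, hc₃, hs₃⟩ := expand_side_of_segCount u E X α β γ₂ s L' L ha₂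
    (hb₂.trans hb₁) hL' hL
    (A * B * B) τ hτ (by linarith) hs₂ hrel
    (fun x hx => (hsm x hx).imp_left fun h => h.trans (hA1.trans hA2)) hE 2
  have hfin : ∀ (i : Fin 3) (γ : Z3), (γ i - α i) * L' ≤ 2 * #X → γ₃ ≤ γ →
      γ₃ i ≤ α i + (2 * #X / L' : ℕ) := by
    intro i γ h1 h2
    have h3 : γ i - α i ≤ (2 * #X : ℤ) / L' := by
      rw [Int.le_ediv_iff_mul_le (by exact_mod_cast hpos)]
      exact h1
    have h4 := h2 i
    push_cast
    linarith
  intro x hx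
  have hx3 : x ∈ tri γ₃ s := by
    refine ⟨fun i => le_trans ?_ (hx.1 i), hx.2⟩
    fin_cases i
    · exact hfin 0 γ₁ hc₁ (hb₃.trans hb₂)
    · exact hfin 1 γ₂ hc₂ hb₃
    · exact hfin 2 γ₃ hc₃ le_rfl
  refine (hs₃ x hx3).trans (le_of_eq ?_)
  rw [hB, mul_assoc, mul_assoc, ← pow_add, ← pow_add]
  congr 2
  ring

/-! ### Covering, thin points, and smallness on almost a whole triangle. -/

/-- The lattice cube of centre `b` and integer radius `r`. -/
def box (b : Z3) (r : ℤ) : Set Z3 := {x | ∀ i, |x i - b i| ≤ r}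

theorem box_mono {b : Z3} {r r' : ℤ} (h : r ≤ r') : box b r ⊆ box b r' :=
  fun _ hx i => (hx i).trans h

open Classical in
/-- A covering argument: if each point of a planar set is the centre of a cube in which `X` has
many points compared with the squared radius, then `X` has many points. -/
theorem card_le_of_dense_boxes (X : Finset Z3) (c : ℝ) (hc : 0 < c) (P : Finset Z3)
    (hP : ∀ x ∈ P, ∀ y ∈ P, x 0 = y 0 → x 1 = y 1 → x = y)
    (h : ∀ b ∈ P, ∃ ρ : ℕ, 1 ≤ ρ ∧ c * (ρ : ℝ) ^ 2 ≤ #{x ∈ X | x ∈ box b ρ}) :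
    c * #P ≤ 25 * #X := by
  choose! ρ hρ1 hρ using h
  induction hn : #P using Nat.strong_induction_on generalizing P X with
  | _ n ih =>
    rcases P.eq_empty_or_nonempty with rfl | hne
    · simp at hn
      subst hn
      simp
    -- Greedy choice of the largest radius. Points of `P` outside the doubled box have boxes
    -- disjoint from that of `b`, so deleting the points of `X` in the box of `b` does not affect
    -- them. The doubled box holds at most (4ρ + 1)² ≤ 25ρ² points of `P`, since `P` projects
    -- injectively to two coordinates.
    obtain ⟨b, hb, hmax⟩ := exists_max_image P ρ hne
    set X' := {x ∈ X | x ∉ box b (ρ b)} with hX'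
    set P' := {y ∈ P | y ∉ box b (2 * ρ b)} with hP'
    have hbP : b ∉ P' := by
      intro hcon
      refine (mem_filter.1 hcon).2 fun i => ?_
      simp
    have hlt : #P' < n := by
      rw [← hn]
      exact card_lt_card ((ssubset_iff_of_subset (filter_subset _ _)).2 ⟨b, hb, hbP⟩)
    have hsubP : ∀ y ∈ P', y ∈ P := fun y hy => (mem_filter.1 hy).1
    have key := ih _ hlt X' P' (fun x hx y hy => hP x (hsubP x hx) y (hsubP y hy))
      (fun y hy => hρ1 y (hsubP y hy)) (by
        intro y hy
        refine (hρ y (hsubP y hy)).trans ?_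
        norm_cast
        refine card_le_card fun x hx => ?_
        obtain ⟨hx1, hx2⟩ := mem_filter.1 hx
        refine mem_filter.2 ⟨mem_filter.2 ⟨hx1, fun hx3 => ?_⟩, hx2⟩
        refine (mem_filter.1 hy).2 fun i => ?_
        have h1 := hx2 i
        have h2 := hx3 i
        have h3 : (ρ y : ℤ) ≤ ρ b := by exact_mod_cast hmax y (hsubP y hy)
        rw [abs_le] at *
        lia) rfl
    have hcardX : (#X : ℝ) = #X' + #{x ∈ X | x ∈ box b (ρ b)} := by
      have := card_filter_add_card_filter_not (s := X) (fun x => x ∈ box b (ρ b))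
      have h2 : (#X : ℝ) = #{x ∈ X | x ∈ box b (ρ b)} + #X' := by exact_mod_cast this.symm
      rw [h2, add_comm]
    have hnear : #{y ∈ P | y ∈ box b (2 * ρ b)} ≤ (4 * ρ b + 1) ^ 2 := by
      have hc1 : #(Icc (b 0 - 2 * ρ b) (b 0 + 2 * ρ b) ×ˢ Icc (b 1 - 2 * ρ b) (b 1 + 2 * ρ b)) =
          (4 * ρ b + 1) ^ 2 := by
        rw [card_product, Int.card_Icc, Int.card_Icc]
        rw [sq]
        congr 1 <;> lia
      rw [← hc1]
      refine card_le_card_of_injOn (fun x => (x 0, x 1)) ?_ ?_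
      · intro x hx
        have h := (mem_filter.1 hx).2
        have h0 := h 0
        have h1 := h 1
        rw [abs_le] at h0 h1
        simp only [coe_product, Set.mem_prod, mem_coe, mem_Icc]
        lia
      · intro x hx y hy hxy
        simp only [Prod.mk.injEq] at hxy
        exact hP x (mem_filter.1 hx).1 y (mem_filter.1 hy).1 hxy.1 hxy.2
    have hcardP : (#P : ℝ) = #P' + #{y ∈ P | y ∈ box b (2 * ρ b)} := by
      have := card_filter_add_card_filter_not (s := P) (fun x => x ∈ box b (2 * ρ b))
      have h2 : (#P : ℝ) = #{x ∈ P | x ∈ box b (2 * ρ b)} + #P' := by exact_mod_cast this.symm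
      rw [h2, add_comm]
    have hnear' : (#{y ∈ P | y ∈ box b (2 * ρ b)} : ℝ) ≤ 25 * (ρ b : ℝ) ^ 2 := by
      have h1 : (#{y ∈ P | y ∈ box b (2 * ρ b)} : ℝ) ≤ (4 * ρ b + 1) ^ 2 := by exact_mod_cast hnear
      have h2 : (1 : ℝ) ≤ ρ b := by exact_mod_cast hρ1 b hb
      nlinarith
    have h3 := hρ b hb
    rw [← hn, hcardP, hcardX]
    have h4 := mul_le_mul_of_nonneg_left hnear' hc.le
    rw [mul_add]
    linarith

/-- `E` is sparse along lattice segments near `b`, at all scales between `M` and `R`, and has at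
most one point in the vicinity of `b` of scale `M`. -/
def Thin (M : ℕ) (E : Set Z3) (b : Z3) (R : ℕ) : Prop :=
  (∀ x ∈ E, ∀ y ∈ E, x ∈ box b (10 * M) → y ∈ box b (10 * M) → x = y) ∧
  ∀ ρ : ℕ, M ≤ ρ → ρ ≤ R → ∀ (x v : Z3) (n : ℕ), IsStep v → ρ ≤ n →
    (∀ k < n, x + (k : ℤ) • v ∈ box b (40 * ρ)) → 1000 * segCount E x v n ≤ n

theorem tri_subset_box (b : Z3) (r : ℕ) (s : ℤ) (hs : ∑ i, b i = s) :
    tri (fun i => b i - r) s ⊆ box b (2 * r) := by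
  intro x hx i
  have h0 := hx.1 i
  have h1 := hx.1 (i + 1)
  have h2 := hx.1 (i + 2)
  have h3 := hx.2
  rw [sum_fin3 _ i] at h3 hs
  rw [abs_le]
  lia

open Classical in
-- Induction by doubling the scale. `expand_triangle` passes from ρ₀ to 3ρ₀ with margin at most ρ₀,
-- hence reaches 2ρ₀ ≥ ρ, and the costs of order ρ₀² sum geometrically into 2400ρ².
theorem small_near_thin_point (M : ℕ) (hM : 10 ≤ M) (u : Z3 → ℝ) (E : Set Z3) (X : Finset Z3)
    (b : Z3) (s : ℤ) (hb : ∑ i, b i = s) (R ρ₁ : ℕ) (hR : ρ₁ ≤ R) (hthin : Thin M E b R)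
    (A τ : ℝ) (hτ : 0 ≤ τ) (hA : τ ≤ A)
    (hrel : TriRel u τ (fun i => b i - 3 * ρ₁) s)
    (hsm : ∀ x ∈ tri (fun i => b i - 3 * ρ₁) s, |u x| ≤ A ∨ x ∈ E ∨ x ∈ X)
    (hX : ∀ ρ : ℕ, M ≤ ρ → ρ ≤ ρ₁ → #{x ∈ X | x ∈ box b (6 * ρ)} * M ^ 2 < ρ ^ 2) :
    ∀ ρ : ℕ, M ≤ ρ → ρ ≤ ρ₁ → ∀ x ∈ tri (fun i => b i - ρ) s, |u x| ≤ 3 * A * 2 ^ (2400 * ρ ^ 2) := by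
  have hA0 : 0 ≤ A := hτ.trans hA
  intro ρ
  induction ρ using Nat.strong_induction_on with
  | _ ρ ih =>
  intro hρM hρ₁ x hx
  by_cases hρ : ρ < 2 * M
  · have hone : (1 : ℝ) ≤ 2 ^ (2400 * ρ ^ 2) := one_le_pow₀ (by norm_num)
    -- At the initial scale the density bound forces a count below 1. The only possible bad point is
    -- then a single point of `E`, whose value follows from the relation on one elementary triangle
    -- through it.
    have hXM : {x ∈ X | x ∈ box b (6 * M)} = ∅ := by
      have := hX M le_rfl (hρM.trans hρ₁)
      rw [← card_eq_zero]
      by_contra hcon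
      have h1 : 1 ≤ #{x ∈ X | x ∈ box b (6 * M)} := by lia
      have h2 := Nat.mul_le_mul_right (M ^ 2) h1
      lia
    have hbase : ∀ y ∈ tri (fun i => b i - (2 * M + 1 : ℕ)) s, |u y| ≤ A ∨ y ∈ E := by
      intro y hy
      have h1 := tri_subset_box b (2 * M + 1) s hb hy
      have h2 : y ∉ X := by
        intro hyX
        have : y ∈ {x ∈ X | x ∈ box b (6 * M)} :=
          mem_filter.2 ⟨hyX, box_mono (by push_cast; lia) h1⟩
        rw [hXM] at this
        simp at this
      have h3 := hsm y ⟨fun i => ?_, hy.2⟩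
      · tauto
      · have := hy.1 i
        push_cast at this
        lia
    have hxt : x ∈ tri (fun i => b i - (2 * M + 1 : ℕ)) s := by
      refine ⟨fun i => ?_, hx.2⟩
      have := hx.1 i
      push_cast at this ⊢
      lia
    suffices |u x| ≤ 3 * A from this.trans (le_mul_of_one_le_right (by positivity) hone)
    rcases hbase x hxt with h | hxE
    · linarith
    have hxb := box_mono (r' := 10 * M) (by push_cast; lia) (tri_subset_box b (2 * M + 1) s hb hxt)
    have hother : ∀ i : Fin 3, i ≠ 0 → |u (x - Pi.single 0 1 + Pi.single i 1)| ≤ A := by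
      intro i hi
      have hmem : x - Pi.single 0 1 + Pi.single i 1 ∈ tri (fun i => b i - (2 * M + 1 : ℕ)) s := by
        refine ⟨fun t => ?_, ?_⟩
        · have h1 := hx.1 t
          simp only [Pi.add_apply, Pi.sub_apply, Pi.single_apply]
          push_cast
          split_ifs <;> lia
        · have := hx.2
          simp only [Pi.add_apply, Pi.sub_apply, sum_add_distrib, sum_sub_distrib, this]
          simp
      rcases hbase _ hmem with h | h
      · exact h
      · exfalso
        have hb' := box_mono (r' := 10 * M) (by push_cast; lia)
          (tri_subset_box b (2 * M + 1) s hb hmem)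
        have heq := congrFun (hthin.1 _ hxE _ h hxb hb') i
        simp [hi] at heq
    have hr := hrel (x - Pi.single 0 1) ⟨fun t => ?_, ?_⟩
    · rw [Fin.sum_univ_three, sub_add_cancel] at hr
      have h1 := hother 1 (by decide)
      have h2 := hother 2 (by decide)
      rw [abs_le] at hr h1 h2 ⊢
      constructor <;> linarith [hr.1, hr.2, h1.1, h1.2, h2.1, h2.2]
    · have h1 := hx.1 t
      simp only [Pi.sub_apply, Pi.single_apply]
      split_ifs <;> lia
    · have := hx.2
      simp only [Pi.sub_apply, sum_sub_distrib, this]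
      simp
  · obtain ⟨ρ₀, hρ₀⟩ : ∃ ρ₀, ρ₀ = (ρ + 1) / 2 := ⟨_, rfl⟩
    have hi := ih ρ₀ (by lia) (by lia) (by lia)
    set X' := {x ∈ X | x ∈ box b (6 * ρ₀)} with hX'
    have hXc := hX ρ₀ (by lia) (by lia)
    have hpow : (1 : ℝ) ≤ 2 ^ (2400 * ρ₀ ^ 2) := one_le_pow₀ (by norm_num)
    have hAA : A ≤ 3 * A * 2 ^ (2400 * ρ₀ ^ 2) := by nlinarith
    have hsub : tri (fun i => b i - 3 * ρ₀) s ⊆ tri (fun i => b i - 3 * ρ₁) s := by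
      intro y hy
      refine ⟨fun i => ?_, hy.2⟩
      have := hy.1 i
      simp only at this ⊢
      lia
    have hbox : tri (fun i => b i - 3 * ρ₀) s ⊆ box b (6 * ρ₀) := by
      have := tri_subset_box b (3 * ρ₀) s hb
      push_cast at this
      rwa [← mul_assoc] at this
    have hexp := expand_triangle u E X' (fun i => b i - 3 * ρ₀) (fun i => b i - ρ₀) s (3 * ρ₀)
      (9 * ρ₀) (fun i => by simp only; lia) (by lia)
      (by rw [← hb, Fin.sum_univ_three, Fin.sum_univ_three]; push_cast; ring)
      (by rw [← hb, Fin.sum_univ_three, Fin.sum_univ_three]; push_cast; ring)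
      (3 * A * 2 ^ (2400 * ρ₀ ^ 2)) τ hτ (hA.trans hAA) hi
      (by
        intro y hy
        refine hrel y ⟨fun i => ?_, hy.2⟩
        have := hy.1 i
        simp only at this ⊢
        lia)
      (by
        intro y hy
        rcases hsm y (hsub hy) with h | h | h
        · exact Or.inl (h.trans hAA)
        · exact Or.inr (Or.inl h)
        · exact Or.inr (Or.inr (mem_filter.2 ⟨h, hbox hy⟩)))
      (by
        intro y v n hv hn1 hn2 hseg
        have := hthin.2 ρ₀ (by lia) (by lia) y v n hv (by lia)
          fun k hk => box_mono (by lia) (hbox (hseg k hk))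
        lia)
    have hd : 2 * #X' / (3 * ρ₀) ≤ ρ₀ := by
      refine Nat.div_le_of_le_mul ?_
      have h1 : #X' * 1 ≤ #X' * M ^ 2 := Nat.mul_le_mul_left _ (Nat.one_le_pow _ _ (by lia))
      nlinarith
    have hxm := hexp x ⟨fun i => ?_, hx.2⟩
    · refine hxm.trans ?_
      rw [mul_assoc, ← pow_add]
      refine mul_le_mul_of_nonneg_left (pow_le_pow_right₀ (by norm_num) ?_) (by positivity)
      have h1 : 10 ≤ ρ₀ := by lia
      have h2 : 2 * ρ₀ ≤ ρ + 1 := by lia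
      nlinarith
    · have h1 := hx.1 i
      have h2 : ((2 * #X' / (3 * ρ₀) : ℕ) : ℤ) ≤ ρ₀ := by exact_mod_cast hd
      simp only at h1 ⊢
      lia

open Classical in
-- At least half the points of an n × n parallelogram are thin. If `X` were concentrated at some
-- scale around each of them, the covering bound would give #X ≥ n² / (2 · 36 · 25 M²), and 2 · 36 ·
-- 25 = 1800.
theorem exists_thin_dense_free_point (M : ℕ) (E : Set Z3) (X : Finset Z3) (α : Z3) (s : ℤ)
    (L g n R : ℕ) (hL : s = ∑ i, α i + L) (hgn : 3 * g + 2 * n ≤ L)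
    (hthin : ∀ x v : Z3, IsStep v → (∀ k < n, x + (k : ℤ) • v ∈ tri α s) →
      2 * segCount {y | ¬ Thin M E y R} x v n ≤ n)
    (hM : 0 < M) (hX : 1800 * M ^ 2 * #X < n ^ 2) :
    ∃ b ∈ tri (fun i => α i + g) s, Thin M E b R ∧
      ∀ ρ : ℕ, M ≤ ρ → #{x ∈ X | x ∈ box b (6 * ρ)} * M ^ 2 < ρ ^ 2 := by
  let pt : ℕ → ℕ → Z3 := fun j k => cyc 0 (α 0 + g + j) (α 1 + g + k) (α 2 + L - 2 * g - j - k)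
  have hpt : ∀ j < n, ∀ k < n, pt j k ∈ tri (fun i => α i + g) s := by
    intro j hj k hk
    rw [Fin.sum_univ_three] at hL
    rw [cyc_mem_tri]
    refine ⟨⟨by lia, ?_, ?_⟩, by lia⟩
    · change α 1 + g ≤ _
      lia
    · change α 2 + g ≤ _
      lia
  have hinj : ∀ p q : ℕ × ℕ, pt p.1 p.2 = pt q.1 q.2 → p = q := by
    rintro ⟨j, k⟩ ⟨j', k'⟩ h
    have h0 := congrFun h 0
    have h1 := congrFun h 1
    have e : ∀ a b c, cyc 0 a b c 1 = b := fun a b c => cyc_one 0 a b c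
    simp only [pt, cyc_zero, e] at h0 h1
    have a : j = j' := by lia
    have b : k = k' := by lia
    rw [a, b]
  set S := (range n).sigma fun j => (range n).filter fun k => Thin M E (pt j k) R with hS
  set P := S.image fun p => pt p.1 p.2 with hP
  have hcardP : n * n ≤ 2 * #P := by
    rw [hP, card_image_of_injOn (by
      rintro ⟨j, k⟩ _ ⟨j', k'⟩ _ h
      have := hinj (j, k) (j', k') h
      simp only [Prod.mk.injEq] at this
      obtain ⟨rfl, rfl⟩ := this
      rfl), hS, card_sigma, mul_sum]
    calc n * n = ∑ j ∈ range n, n := by simp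
      _ ≤ _ := by
        refine sum_le_sum fun j hj => ?_
        rw [mem_range] at hj
        have e : ∀ k : ℕ, pt j 0 + (k : ℤ) • cyc 0 0 1 (-1) = pt j k := by
          intro k
          funext t
          fin_cases t <;> simp [pt, cyc]
          ring
        have h1 := hthin (pt j 0) (cyc 0 0 1 (-1)) (isStep_cyc 0) (by
          intro k hk
          rw [e]
          have := hpt j hj k hk
          refine ⟨fun i => ?_, this.2⟩
          have := this.1 i
          lia)
        rw [segCount] at h1
        simp only [e, Set.mem_ofPred_eq] at h1
        have h2 := card_filter_add_card_filter_not (s := range n) (fun k => Thin M E (pt j k) R)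
        rw [card_range] at h2
        lia
  by_contra hcon
  push Not at hcon
  have hPmem : ∀ b ∈ P, b ∈ tri (fun i => α i + g) s ∧ Thin M E b R := by
    intro b hb
    obtain ⟨⟨j, k⟩, hjk, rfl⟩ := mem_image.1 hb
    rw [hS, mem_sigma, mem_filter, mem_range, mem_range] at hjk
    exact ⟨hpt j hjk.1 k hjk.2.1, hjk.2.2⟩
  have hM' : (0 : ℝ) < M := by exact_mod_cast hM
  have key := card_le_of_dense_boxes X (1 / (36 * (M : ℝ) ^ 2)) (by positivity) P (by
    intro x hx y hy h0 h1
    have hx' := (hPmem x hx).1.2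
    have hy' := (hPmem y hy).1.2
    rw [Fin.sum_univ_three] at hx' hy'
    funext t
    rcases fin3_cases 0 t with rfl | rfl | rfl
    · exact h0
    · exact h1
    · change x 2 = y 2
      lia) (by
    intro b hb
    obtain ⟨ρ, h1, h2⟩ := hcon b (hPmem b hb).1 (hPmem b hb).2
    refine ⟨6 * ρ, by lia, ?_⟩
    push_cast
    have h3 : (ρ : ℝ) ^ 2 ≤ #{x ∈ X | x ∈ box b (6 * ρ)} * (M : ℝ) ^ 2 := by exact_mod_cast h2
    rw [div_mul_eq_mul_div, div_le_iff₀ (by positivity)]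
    nlinarith)
  have h1 : (n : ℝ) * n ≤ 2 * #P := by exact_mod_cast hcardP
  have h2 : 1800 * (M : ℝ) ^ 2 * #X < n ^ 2 := by exact_mod_cast hX
  rw [div_mul_eq_mul_div, div_le_iff₀ (by positivity)] at key
  nlinarith

/-- A function on a triangle which nearly satisfies the three-term relation and has few large
values is small on almost all of the triangle. -/
theorem small_on_triangle (M : ℕ) (hM : 10 ≤ M) (u : Z3 → ℝ) (E : Set Z3) (X : Finset Z3) (α : Z3)
    (s : ℤ) (L : ℕ) (hL : s = ∑ i, α i + L) (hLM : 1000 * M ≤ L)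
    (A τ : ℝ) (hτ : 0 ≤ τ) (hA : τ ≤ A) (hrel : TriRel u τ α s)
    (hsm : ∀ x ∈ tri α s, |u x| ≤ A ∨ x ∈ E ∨ x ∈ X)
    (hthin : ∀ (x v : Z3) (n : ℕ), IsStep v → L ≤ 5 * n → (∀ k < n, x + (k : ℤ) • v ∈ tri α s) →
      2 * segCount {y | ¬ Thin M E y L} x v n ≤ n)
    (hX : 45000 * M ^ 2 * #X < L ^ 2) :
    ∀ x ∈ tri (fun i => α i + (100 * #X / L : ℕ)) s, |u x| ≤ A * 2 ^ (3000 * L ^ 2) := by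
  classical
  have hA0 : 0 ≤ A := hτ.trans hA
  -- The margin `g` leaves room for triangles of scale 3ρ around the point found, with ρ = g / 3.
  -- Since n > L / 5, the constant 1800 becomes 25 · 1800 = 45000.
  obtain ⟨g, hg⟩ : ∃ g, g = L / 6 := ⟨_, rfl⟩
  obtain ⟨n, hn⟩ : ∃ n, n = L / 5 + 1 := ⟨_, rfl⟩
  obtain ⟨b, hbt, hbthin, hdens⟩ := exists_thin_dense_free_point M E X α s L g n L hL
    (by lia) (fun x v hv hseg => hthin x v n hv (by lia) hseg) (by lia) (by
      have h1 : L < 5 * n := by lia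
      have h2 : L ^ 2 < 25 * n ^ 2 := by nlinarith
      nlinarith)
  obtain ⟨ρ, hρ⟩ : ∃ ρ, ρ = g / 3 := ⟨_, rfl⟩
  have hbs := hbt.2
  have hbα : ∀ i, α i + g ≤ b i := hbt.1
  have hnear := small_near_thin_point M hM u E X b s hbs L ρ (by lia) hbthin A τ hτ hA
    (by
      intro y hy
      refine hrel y ⟨fun i => ?_, hy.2⟩
      have h1 := hy.1 i
      have h2 := hbα i
      simp only at h1
      lia)
    (by
      intro y hy
      refine hsm y ⟨fun i => ?_, hy.2⟩
      have h1 := hy.1 i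
      have h2 := hbα i
      simp only at h1
      lia)
    (fun ρ' h1 _ => hdens ρ' h1) ρ (by lia) le_rfl
  have hpow : (1 : ℝ) ≤ 2 ^ (2400 * ρ ^ 2) := one_le_pow₀ (by norm_num)
  have hAA : A ≤ 3 * A * 2 ^ (2400 * ρ ^ 2) := by nlinarith
  have hexp := expand_triangle u E X α (fun i => b i - ρ) s (3 * ρ) L
    (fun i => by have := hbα i; simp only; lia) (by lia)
    (by rw [← hbs, Fin.sum_univ_three, Fin.sum_univ_three]; push_cast; ring) hL
    (3 * A * 2 ^ (2400 * ρ ^ 2)) τ hτ (hA.trans hAA) hnear hrel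
    (fun y hy => (hsm y hy).imp_left fun h => h.trans hAA)
    (by
      intro y v m hv hm1 hm2 hseg
      have := hbthin.2 ρ (by lia) (by lia) y v m hv (by lia) (by
        intro k hk i
        have h := hseg k hk
        have h0 := h.1 i
        have h1 := h.1 (i + 1)
        have h2 := h.1 (i + 2)
        have h3 := h.2
        have b0 := hbα i
        have b1 := hbα (i + 1)
        have b2 := hbα (i + 2)
        rw [sum_fin3 _ i] at h3 hL hbs
        rw [abs_le]
        lia)
      lia)
  have hd : 2 * #X / (3 * ρ) ≤ 100 * #X / L := by
    rw [Nat.le_div_iff_mul_le (by lia)]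
    have h1 : 2 * #X / (3 * ρ) * (3 * ρ) ≤ 2 * #X := Nat.div_mul_le_self _ _
    have h2 : L ≤ 50 * (3 * ρ) := by lia
    calc 2 * #X / (3 * ρ) * L ≤ 2 * #X / (3 * ρ) * (50 * (3 * ρ)) := Nat.mul_le_mul_left _ h2
      _ = 50 * (2 * #X / (3 * ρ) * (3 * ρ)) := by ring
      _ ≤ 50 * (2 * #X) := Nat.mul_le_mul_left _ h1
      _ = 100 * #X := by ring
  intro x hx
  have hxm := hexp x ⟨fun i => ?_, hx.2⟩
  · refine hxm.trans ?_
    have h3 : 3 * A ≤ A * 2 ^ 2 := by linarith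
    calc 3 * A * 2 ^ (2400 * ρ ^ 2) * 2 ^ (24 * (L + 1) ^ 2)
        ≤ A * 2 ^ 2 * 2 ^ (2400 * ρ ^ 2) * 2 ^ (24 * (L + 1) ^ 2) := by gcongr
      _ = A * 2 ^ (2 + 2400 * ρ ^ 2 + 24 * (L + 1) ^ 2) := by rw [pow_add, pow_add]; ring
      _ ≤ A * 2 ^ (3000 * L ^ 2) := by
        refine mul_le_mul_of_nonneg_left (pow_le_pow_right₀ (by norm_num) ?_) hA0
        have h4 : ρ ≤ L := by lia
        have h5 : 1000 ≤ L := by lia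
        nlinarith
  · have h1 := hx.1 i
    have h2 : ((2 * #X / (3 * ρ) : ℕ) : ℤ) ≤ (100 * #X / L : ℕ) := by exact_mod_cast hd
    simp only at h1 ⊢
    lia

/-! ### From planes to space: dodecahedra and tetrahedra. -/

theorem abs_neighbour_le (u V : Z3 → ℝ) (K A : ℝ) (y : Z3) (heq : laplacian u y = V y * u y)
    (hV : |V y| ≤ K) (i : Fin 3) (σ : ℤ) (hσ : σ = 1 ∨ σ = -1) (h0 : |u y| ≤ A)
    (h1 : |u (y - Pi.single i σ)| ≤ A)
    (h2 : ∀ j, j ≠ i → |u (y + Pi.single j 1)| ≤ A ∧ |u (y - Pi.single j 1)| ≤ A) :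
    |u (y + Pi.single i σ)| ≤ (K + 11) * A := by
  obtain ⟨hi1, hi2, hi3⟩ := fin3_ne i
  have hA : 0 ≤ A := (abs_nonneg _).trans h0
  have hVu : |V y * u y| ≤ K * A := by
    rw [abs_mul]
    exact mul_le_mul hV h0 (abs_nonneg _) ((abs_nonneg _).trans hV)
  rw [laplacian, sum_fin3 _ i] at heq
  obtain ⟨a1, a2⟩ := h2 _ hi1
  obtain ⟨a3, a4⟩ := h2 _ hi2
  have hsum : u (y + Pi.single i 1) + u (y - Pi.single i 1) =
      u (y + Pi.single i σ) + u (y - Pi.single i σ) := by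
    rcases hσ with rfl | rfl
    · rfl
    · rw [Pi.single_neg, sub_neg_eq_add, ← sub_eq_add_neg, add_comm]
  rw [abs_le] at *
  constructor <;>
    linarith [h0.1, h0.2, h1.1, h1.2, a1.1, a1.2, a2.1, a2.2, a3.1, a3.2, a4.1, a4.2, hVu.1, hVu.2]

/-- Beyond a face of the cube, a value is determined by the equation at the point one layer below.
This needs the four lateral neighbours of that point, so the cross-section loses one in radius per
layer. -/
theorem small_on_pyramid (u V : Z3 → ℝ) (K A : ℝ) (hK : 0 ≤ K) (b : Z3) (r : ℕ)
    (heq : ∀ x ∈ box b (2 * r), laplacian u x = V x * u x) (hV : ∀ x ∈ box b (2 * r), |V x| ≤ K)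
    (hs : ∀ x ∈ box b r, |u x| ≤ A) (i : Fin 3) (σ : ℤ) (hσ : σ = 1 ∨ σ = -1) (t : ℕ) :
    t ≤ r → ∀ x : Z3, -(r : ℤ) ≤ σ * (x i - b i) → σ * (x i - b i) ≤ r + t →
      (∀ j, j ≠ i → |x j - b j| ≤ r - t) → |u x| ≤ A * (K + 12) ^ t := by
  have hA : 0 ≤ A := (abs_nonneg _).trans (hs b fun i => by simp)
  induction t with
  | zero =>
    intro _ x h1 h2 h3
    rw [pow_zero, mul_one]
    refine hs x fun j => ?_
    by_cases hj : j = i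
    · subst hj
      rw [abs_le]
      rcases hσ with rfl | rfl <;> push_cast at * <;> lia
    · simpa using h3 j hj
  | succ t ih =>
    intro ht x h1 h2 h3
    push_cast at h2 h3
    by_cases hx : σ * (x i - b i) ≤ r + t
    · refine (ih (by lia) x h1 hx fun j hj => (h3 j hj).trans (by lia)).trans ?_
      refine mul_le_mul_of_nonneg_left (pow_le_pow_right₀ (by linarith) (by lia)) hA
    · have hxv : σ * (x i - b i) = r + t + 1 := by lia
      have hσσ : σ * σ = 1 := by rcases hσ with rfl | rfl <;> rfl
      have hB : A * (K + 12) ^ (t + 1) = (K + 12) * (A * (K + 12) ^ t) := by ring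
      have hpos : 0 ≤ A * (K + 12) ^ t := by positivity
      have hy : x = (x - Pi.single i σ) + Pi.single i σ := by simp
      have hyb : x - Pi.single i σ ∈ box b (2 * r) := by
        intro j
        by_cases hj : j = i
        · subst hj
          simp only [Pi.sub_apply, Pi.single_eq_same, abs_le]
          rcases hσ with rfl | rfl <;> lia
        · have := h3 j hj
          simp only [Pi.sub_apply, Pi.single_apply, hj, if_false, abs_le] at this ⊢
          lia
      rw [hy, hB]
      refine (abs_neighbour_le u V K (A * (K + 12) ^ t) _ (heq _ hyb) (hV _ hyb) i σ hσ ?_ ?_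
        ?_).trans (by nlinarith)
      · refine ih (by lia) _ ?_ ?_ ?_
        · simp only [Pi.sub_apply, Pi.single_eq_same]
          linarith [mul_sub σ (x i - σ) (b i), mul_sub σ (x i) σ, mul_sub σ (x i) (b i)]
        · simp only [Pi.sub_apply, Pi.single_eq_same]
          linarith [mul_sub σ (x i - σ) (b i), mul_sub σ (x i) σ, mul_sub σ (x i) (b i)]
        · intro j hj
          have := h3 j hj
          simp only [Pi.sub_apply, Pi.single_apply, hj, if_false, abs_le] at this ⊢
          lia
      · refine ih (by lia) _ ?_ ?_ ?_
        · simp only [Pi.sub_apply, Pi.single_eq_same]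
          linarith [mul_sub σ (x i - σ - σ) (b i), mul_sub σ (x i - σ) σ, mul_sub σ (x i) σ,
            mul_sub σ (x i) (b i)]
        · simp only [Pi.sub_apply, Pi.single_eq_same]
          linarith [mul_sub σ (x i - σ - σ) (b i), mul_sub σ (x i - σ) σ, mul_sub σ (x i) σ,
            mul_sub σ (x i) (b i)]
        · intro j hj
          have := h3 j hj
          simp only [Pi.sub_apply, Pi.single_apply, hj, if_false, abs_le] at this ⊢
          lia
      · intro k hk
        have hval : σ * (x i - σ - b i) = r + t := by
          linarith [mul_sub σ (x i - σ) (b i), mul_sub σ (x i) σ, mul_sub σ (x i) (b i)]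
        constructor
        · refine ih (by lia) _ ?_ ?_ ?_
          · simp only [Pi.sub_apply, Pi.add_apply, Pi.single_apply, hk.symm, if_true, if_false,
              add_zero, hval]
            lia
          · simp only [Pi.sub_apply, Pi.add_apply, Pi.single_apply, hk.symm, if_true, if_false,
              add_zero, hval]
            lia
          · intro j hj
            have := h3 j hj
            simp only [Pi.sub_apply, Pi.add_apply, Pi.single_apply, hj, if_false, abs_le] at this ⊢
            split_ifs <;> lia
        · refine ih (by lia) _ ?_ ?_ ?_
          · simp only [Pi.sub_apply, Pi.single_apply, hk.symm, if_true, if_false,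
              sub_zero, hval]
            lia
          · simp only [Pi.sub_apply, Pi.single_apply, hk.symm, if_true, if_false,
              sub_zero, hval]
            lia
          · intro j hj
            have := h3 j hj
            simp only [Pi.sub_apply, Pi.single_apply, hj, if_false, abs_le] at this ⊢
            split_ifs <;> lia

/-- The cube with the six pyramids on its faces is a rhombic dodecahedron. No sparsity is needed
here, and the gain makes room for the bases of the tetrahedra. -/
theorem small_on_dodecahedron (u V : Z3 → ℝ) (K A : ℝ) (hK : 0 ≤ K) (b : Z3) (r : ℕ)
    (heq : ∀ x ∈ box b (2 * r), laplacian u x = V x * u x) (hV : ∀ x ∈ box b (2 * r), |V x| ≤ K)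
    (hs : ∀ x ∈ box b r, |u x| ≤ A) (x : Z3)
    (hx : ∀ i j, i ≠ j → |x i - b i| + |x j - b j| ≤ 2 * r) : |u x| ≤ A * (K + 12) ^ r := by
  have hA : 0 ≤ A := (abs_nonneg _).trans (hs b fun i => by simp)
  by_cases hb : x ∈ box b r
  · exact (hs x hb).trans (le_mul_of_one_le_right hA (one_le_pow₀ (by linarith)))
  · simp only [box, Set.mem_ofPred_eq, not_forall, not_le] at hb
    obtain ⟨i, hi⟩ := hb
    obtain ⟨t, ht⟩ := Int.eq_ofNat_of_zero_le (a := |x i - b i| - r) (by lia)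
    have htr : t ≤ r := by
      have h1 := hx i (i + 1) (fin3_ne i).1.symm
      have h2 := abs_nonneg (x (i + 1) - b (i + 1))
      lia
    have hσ : ∃ σ : ℤ, (σ = 1 ∨ σ = -1) ∧ σ * (x i - b i) = |x i - b i| := by
      rcases abs_cases (x i - b i) with h | h
      · exact ⟨1, Or.inl rfl, by rw [h.1, one_mul]⟩
      · exact ⟨-1, Or.inr rfl, by rw [h.1]; ring⟩
    obtain ⟨σ, hσ, hσx⟩ := hσ
    refine (small_on_pyramid u V K A hK b r heq hV hs i σ hσ t htr x (by rw [hσx]; lia)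
      (by rw [hσx]; lia) fun j hj => ?_).trans ?_
    · have := hx i j hj.symm
      lia
    · exact mul_le_mul_of_nonneg_left (pow_le_pow_right₀ (by linarith) htr) hA

theorem Thin.mono {M : ℕ} {E : Set Z3} {b : Z3} {R R' : ℕ} (h : Thin M E b R) (hR : R' ≤ R) :
    Thin M E b R' :=
  ⟨h.1, fun ρ h1 h2 => h.2 ρ h1 (h2.trans hR)⟩

theorem segCount_mono {S T : Set Z3} (h : S ⊆ T) (x v : Z3) (n : ℕ) :
    segCount S x v n ≤ segCount T x v n := by
  classical
  exact card_le_card fun k hk => mem_filter.2 ⟨(mem_filter.1 hk).1, h (mem_filter.1 hk).2⟩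

/-- The six neighbours of a point on level s - 1 split into three on level s and three on level s -
2, whence (K + 6)A + 3A. -/
theorem triRel_of_small (u V : Z3 → ℝ) (K A : ℝ) (α : Z3) (s : ℤ)
    (heq : ∀ x ∈ tri α (s - 1), laplacian u x = V x * u x) (hV : ∀ x ∈ tri α (s - 1), |V x| ≤ K)
    (h1 : ∀ x ∈ tri α (s - 1), |u x| ≤ A)
    (h2 : ∀ x ∈ tri (fun i => α i - 1) (s - 2), |u x| ≤ A) : TriRel u ((K + 9) * A) α s := by
  intro b hb
  have e := heq b hb
  have hVb := hV b hb
  have hub := h1 b hb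
  have hVu : |V b * u b| ≤ K * A := by
    rw [abs_mul]
    exact mul_le_mul hVb hub (abs_nonneg _) ((abs_nonneg _).trans hVb)
  have hlow : ∀ i : Fin 3, |u (b - Pi.single i 1)| ≤ A := by
    intro i
    refine h2 _ ⟨fun t => ?_, ?_⟩
    · have := hb.1 t
      simp only [Pi.sub_apply, Pi.single_apply]
      split_ifs <;> lia
    · have := hb.2
      simp only [Pi.sub_apply, sum_sub_distrib, this]
      simp
      ring
  have a0 := hlow 0
  have a1 := hlow 1
  have a2 := hlow 2
  rw [laplacian, Fin.sum_univ_three] at e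
  rw [Fin.sum_univ_three]
  rw [abs_le] at *
  constructor <;> linarith [a0.1, a0.2, a1.1, a1.2, a2.1, a2.2, hVu.1, hVu.2, hub.1, hub.2]

open Classical in
/-- Smallness on two consecutive triangles propagates through the tetrahedron above them, up to
a margin controlled by the number of exceptional points. -/
theorem small_in_tetrahedron (M : ℕ) (hM : 10 ≤ M) (u V : Z3 → ℝ) (K A : ℝ) (hK : 0 ≤ K)
    (E : Set Z3) (X : Finset Z3) (γ : Z3) (s₀ : ℤ) (l q R : ℕ) (hs₀ : s₀ = ∑ i, γ i + l)
    (hq : 1000 * M ≤ q) (hlR : l ≤ R)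
    (heq : ∀ x ∈ Set.Icc γ (fun i => γ i + l), laplacian u x = V x * u x)
    (hV : ∀ x ∈ Set.Icc γ (fun i => γ i + l), |V x| ≤ K)
    (h0 : ∀ x ∈ tri γ s₀, |u x| ≤ A) (h1 : ∀ x ∈ tri γ (s₀ - 1), |u x| ≤ A)
    (hsm : ∀ x ∈ Set.Icc γ (fun i => γ i + l), |u x| ≤ A ∨ x ∈ E ∨ x ∈ X)
    (hthin : ∀ (x v : Z3) (n : ℕ), IsStep v → q ≤ 5 * n →
      (∀ k < n, x + (k : ℤ) • v ∈ Set.Icc γ (fun i => γ i + l)) →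
      2 * segCount {y | ¬ Thin M E y R} x v n ≤ n)
    (hX : 45000 * M ^ 2 * #X < q ^ 2) (t : ℕ) (ht : t + 3 * q ≤ 2 * l) :
    ∃ D : ℕ, D * q ≤ 100 * #{x ∈ X | ∑ i, x i ≤ s₀ + t} ∧
      (∀ x ∈ tri (fun i => γ i + ((t + 1) / 2 + D : ℕ)) (s₀ + t),
        |u x| ≤ A * ((K + 9) * 2 ^ (3000 * l ^ 2)) ^ t) ∧
      ∀ x ∈ tri (fun i => γ i + (t / 2 + D : ℕ)) (s₀ + t - 1),
        |u x| ≤ A * ((K + 9) * 2 ^ (3000 * l ^ 2)) ^ t := by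
  induction t with
  | zero => exact ⟨0, by simp, by simpa using h0, by simpa using h1⟩
  | succ t ih =>
    obtain ⟨D, hD, hDt, hDt'⟩ := ih (by lia)
    set B : ℝ := (K + 9) * 2 ^ (3000 * l ^ 2) with hB
    have hp1 : (1 : ℝ) ≤ 2 ^ (3000 * l ^ 2) := one_le_pow₀ (by norm_num)
    have hB1 : 1 ≤ B := by rw [hB]; nlinarith
    have hMX : 1000 * #X ≤ 45000 * M ^ 2 * #X := Nat.mul_le_mul_right _ (by nlinarith)
    have hDq : 10 * D ≤ q := by
      have h2 : #{x ∈ X | ∑ i, x i ≤ s₀ + t} ≤ #X := card_le_card (filter_subset _ _)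
      by_contra hcon
      have h3 : q * q < 10 * D * q := Nat.mul_lt_mul_of_pos_right (by lia) (by lia)
      nlinarith
    obtain ⟨L, hL⟩ : ∃ L, L = l + t + 1 - 3 * ((t + 2) / 2) - 3 * D := ⟨_, rfl⟩
    have hLq : q ≤ L := by lia
    have hLl : L ≤ l := by lia
    have hA : 0 ≤ A := by
      have : (fun i => if i = 0 then γ 0 + l else γ i : Z3) ∈ tri γ s₀ := by
        refine ⟨fun i => ?_, ?_⟩
        · by_cases h : i = 0
          · subst h
            simp
          · simp [h]
        · rw [hs₀, Fin.sum_univ_three, Fin.sum_univ_three]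
          simp
          ring
      exact (abs_nonneg _).trans (h0 _ this)
    -- The relation on the new layer uses the layer below with the same corner and the one below
    -- that with corner lowered by one, so geometry raises the corner by one every two layers.
    set α : Z3 := fun i => γ i + ((t + 2) / 2 + D : ℕ) with hα
    -- Only the exceptional points of this layer enter its margin; hence the margins sum to at most
    -- 100 #X / q.
    set X' := {x ∈ X | ∑ i, x i = s₀ + (t + 1 : ℕ)} with hX'
    have hX'X : #X' ≤ #X := card_le_card (filter_subset _ _)
    have hA' : 0 ≤ A * B ^ t := by positivity
    have hAA : A ≤ (K + 9) * (A * B ^ t) := by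
      have : 1 ≤ B ^ t := one_le_pow₀ hB1
      have h2 : A ≤ A * B ^ t := le_mul_of_one_le_right hA this
      nlinarith
    have hin : ∀ x ∈ tri α (s₀ + t), x ∈ Set.Icc γ (fun i => γ i + l) := by
      intro x hx
      have a0 := hx.1
      have a3 := hx.2
      simp only [hα] at a0
      refine ⟨fun i => by have := a0 i; lia, fun i => ?_⟩
      rw [hs₀, sum_fin3 _ i, sum_fin3 _ i] at a3
      have b1 := a0 (i + 1)
      have b2 := a0 (i + 2)
      simp only
      lia
    have hin' : ∀ x ∈ tri α (s₀ + (t + 1 : ℕ)), x ∈ Set.Icc γ (fun i => γ i + l) := by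
      intro x hx
      have a0 := hx.1
      have a3 := hx.2
      simp only [hα] at a0
      refine ⟨fun i => by have := a0 i; lia, fun i => ?_⟩
      rw [hs₀, sum_fin3 _ i, sum_fin3 _ i] at a3
      have b1 := a0 (i + 1)
      have b2 := a0 (i + 2)
      simp only
      lia
    have hstart : ∀ x ∈ tri α (s₀ + t), |u x| ≤ A * B ^ t := by
      intro x hx
      refine hDt x ⟨fun i => ?_, hx.2⟩
      have := hx.1 i
      simp only [hα] at this
      lia
    have es : s₀ + ((t + 1 : ℕ) : ℤ) - 1 = s₀ + t := by push_cast; ring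
    have htri := small_on_triangle M hM u E X' α (s₀ + (t + 1 : ℕ)) L
      (by
        rw [hs₀, Fin.sum_univ_three, Fin.sum_univ_three]
        simp only [hα]
        lia) (hq.trans hLq) ((K + 9) * (A * B ^ t)) ((K + 9) * (A * B ^ t)) (by positivity) le_rfl
      (triRel_of_small u V K _ α _ (fun x hx => heq x (hin x (es ▸ hx)))
        (fun x hx => hV x (hin x (es ▸ hx))) (fun x hx => hstart x (es ▸ hx)) (by
          intro x hx
          refine hDt' x ⟨fun i => ?_, by rw [hx.2]; push_cast; ring⟩
          have := hx.1 i
          simp only [hα] at this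
          lia))
      (by
        intro x hx
        rcases hsm x (hin' x hx) with h | h | h
        · exact Or.inl (h.trans hAA)
        · exact Or.inr (Or.inl h)
        · exact Or.inr (Or.inr (mem_filter.2 ⟨h, hx.2⟩)))
      (by
        intro x v n hv hn hseg
        refine le_trans (Nat.mul_le_mul_left 2 (segCount_mono ?_ x v n))
          (hthin x v n hv (hLq.trans hn) fun k hk => hin' _ (hseg k hk))
        intro y hy hcon
        exact hy (hcon.mono (hLl.trans hlR)))
      (by
        calc 45000 * M ^ 2 * #X' ≤ 45000 * M ^ 2 * #X := Nat.mul_le_mul_left _ hX'X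
          _ < q ^ 2 := hX
          _ ≤ L ^ 2 := Nat.pow_le_pow_left hLq 2)
    refine ⟨D + 100 * #X' / L, ?_, ?_, ?_⟩
    · have h2 : 100 * #X' / L * q ≤ 100 * #X' :=
        (Nat.mul_le_mul_left _ hLq).trans (Nat.div_mul_le_self _ _)
      have h3 : #{x ∈ X | ∑ i, x i ≤ s₀ + t} + #X' ≤
          #{x ∈ X | ∑ i, x i ≤ s₀ + (t + 1 : ℕ)} := by
        rw [← card_union_of_disjoint]
        · refine card_le_card fun x hx => ?_
          rcases mem_union.1 hx with h | h
          · obtain ⟨a, b⟩ := mem_filter.1 h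
            exact mem_filter.2 ⟨a, by lia⟩
          · obtain ⟨a, b⟩ := mem_filter.1 h
            exact mem_filter.2 ⟨a, by lia⟩
        · rw [disjoint_left]
          intro x h h'
          have := (mem_filter.1 h).2
          have := (mem_filter.1 h').2
          lia
      rw [add_mul]
      lia
    · intro x hx
      refine (htri x ⟨fun i => ?_, hx.2⟩).trans ?_
      · have := hx.1 i
        simp only [hα] at this ⊢
        lia
      · calc (K + 9) * (A * B ^ t) * 2 ^ (3000 * L ^ 2)
            ≤ (K + 9) * (A * B ^ t) * 2 ^ (3000 * l ^ 2) := by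
              refine mul_le_mul_of_nonneg_left (pow_le_pow_right₀ (by norm_num) ?_) (by positivity)
              exact Nat.mul_le_mul_left _ (Nat.pow_le_pow_left hLl 2)
          _ = A * B ^ (t + 1) := by rw [hB]; ring
    · intro x hx
      refine (hDt x ⟨fun i => ?_, by rw [hx.2]; push_cast; ring⟩).trans ?_
      · have := hx.1 i
        simp only at this ⊢
        lia
      · exact mul_le_mul_of_nonneg_left (pow_le_pow_right₀ hB1 (by lia)) hA

/-! ### Reflections and growth of cubes. -/

/-- The reflection `x ↦ b + σ x`, where `σ` is a vector of signs. -/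
def reflect (b σ : Z3) (hσ : ∀ i, σ i * σ i = 1) : Z3 ≃ Z3 where
  toFun x i := b i + σ i * x i
  invFun y i := σ i * (y i - b i)
  left_inv x := by
    funext i
    simp only [add_sub_cancel_left, ← mul_assoc, hσ, one_mul]
  right_inv y := by
    funext i
    simp only [← mul_assoc, hσ, one_mul, add_sub_cancel]

section reflect

variable {b σ : Z3} {hσ : ∀ i, σ i * σ i = 1}

theorem sign_eq (hσ : ∀ i, σ i * σ i = 1) (i : Fin 3) : σ i = 1 ∨ σ i = -1 :=
  mul_self_eq_one_iff.1 (hσ i)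

theorem reflect_apply (x : Z3) (i : Fin 3) : reflect b σ hσ x i = b i + σ i * x i := rfl

theorem reflect_add_smul (x v : Z3) (k : ℤ) :
    reflect b σ hσ (x + k • v) = reflect b σ hσ x + k • (σ * v) := by
  funext i
  simp only [reflect_apply, Pi.add_apply, Pi.smul_apply, Pi.mul_apply, smul_eq_mul]
  ring

theorem reflect_mem_box (x y : Z3) (r : ℤ) :
    reflect b σ hσ x ∈ box (reflect b σ hσ y) r ↔ x ∈ box y r := by
  refine forall_congr' fun i => ?_
  rw [reflect_apply, reflect_apply]
  rcases sign_eq hσ i with h | h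
  · rw [h]
    ring_nf
  · rw [h, ← abs_neg]
    ring_nf

theorem isStep_mul (hσ : ∀ i, σ i * σ i = 1) {v : Z3} (hv : IsStep v) : IsStep (σ * v) := by
  refine ⟨fun h => hv.1 ?_, fun i => ?_⟩
  · funext i
    have h1 : σ i * v i = 0 := congrFun h i
    have h2 := hσ i
    rcases mul_eq_zero.1 h1 with h3 | h3
    · rw [h3] at h2
      simp at h2
    · exact h3
  · have := hv.2 i
    rcases sign_eq hσ i with h | h <;> simpa [h] using this

theorem segCount_reflect (S : Set Z3) (x v : Z3) (n : ℕ) :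
    segCount (reflect b σ hσ ⁻¹' S) x v n = segCount S (reflect b σ hσ x) (σ * v) n := by
  classical
  rw [segCount, segCount]
  congr 1
  refine filter_congr fun k _ => ?_
  rw [Set.mem_preimage, reflect_add_smul]

theorem Thin.reflect {M : ℕ} {E : Set Z3} {x : Z3} {R : ℕ}
    (h : Thin M E (reflect b σ hσ x) R) : Thin M (DiscreteUCP.reflect b σ hσ ⁻¹' E) x R := by
  refine ⟨fun y hy z hz h1 h2 => ?_, fun ρ h1 h2 y v n hv hn hseg => ?_⟩
  · refine (DiscreteUCP.reflect b σ hσ).injective (h.1 _ hy _ hz ?_ ?_)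
    · rwa [reflect_mem_box]
    · rwa [reflect_mem_box]
  · rw [segCount_reflect]
    refine h.2 ρ h1 h2 _ _ n (isStep_mul hσ hv) hn fun k hk => ?_
    rw [← reflect_add_smul, reflect_mem_box]
    exact hseg k hk

theorem laplacian_reflect (u : Z3 → ℝ) (x : Z3) :
    laplacian (fun y => u (reflect b σ hσ y)) x = laplacian u (reflect b σ hσ x) := by
  rw [laplacian, laplacian]
  congr 1
  refine sum_congr rfl fun i _ => ?_
  have e : ∀ k : ℤ, reflect b σ hσ (x + k • Pi.single i 1) =
      reflect b σ hσ x + (k * σ i) • Pi.single i 1 := by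
    intro k
    rw [reflect_add_smul]
    funext j
    by_cases hj : j = i
    · subst hj
      simp
    · simp [hj]
  have e1 := e 1
  have e2 := e (-1)
  simp only [one_smul, neg_smul, ← sub_eq_add_neg, one_mul] at e1 e2
  rw [e1, e2]
  rcases sign_eq hσ i with h | h
  · simp [h, sub_eq_add_neg]
  · simp [h, sub_eq_add_neg]
    ring

end reflect

/-- Smallness propagates from a cube to a larger concentric cube, if there are few exceptional
points. -/
theorem grow_box (M : ℕ) (hM : 10 ≤ M) (u V : Z3 → ℝ) (K A : ℝ) (hK : 0 ≤ K) (E : Set Z3)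
    (X : Finset Z3) (b : Z3) (r : ℕ) (hr : 10000 * M ≤ r)
    (heq : ∀ x ∈ box b (3 * r), laplacian u x = V x * u x) (hV : ∀ x ∈ box b (3 * r), |V x| ≤ K)
    (hs : ∀ x ∈ box b r, |u x| ≤ A)
    (hsm : ∀ x ∈ box b (3 * r), |u x| ≤ A ∨ x ∈ E ∨ x ∈ X)
    (hthin : ∀ (x v : Z3) (n : ℕ), IsStep v → r ≤ 100 * n →
      (∀ k < n, x + (k : ℤ) • v ∈ box b (3 * r)) → 2 * segCount {y | ¬ Thin M E y r} x v n ≤ n)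
    (hX : 45000 * M ^ 2 * #X < (r / 10) ^ 2) :
    ∀ p ∈ box b (r + r / 10 : ℕ), |u p| ≤ A * ((K + 12) * 2 ^ 3000) ^ r ^ 3 := by
  classical
  intro p hp
  have hA : 0 ≤ A := (abs_nonneg _).trans (hs b fun i => by simp)
  obtain ⟨σ, hσ, hσp⟩ : ∃ σ : Z3, (∀ i, σ i * σ i = 1) ∧ ∀ i, 0 ≤ σ i * (p i - b i) := by
    refine ⟨fun i => if b i ≤ p i then 1 else -1, fun i => ?_, fun i => ?_⟩
    · simp only
      split_ifs <;> rfl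
    · simp only
      split_ifs <;> lia
  set φ := reflect b σ hσ with hφ
  have hφ0 : φ 0 = b := by
    funext i
    simp [hφ, reflect_apply]
  have hbox : ∀ x (k : ℤ), φ x ∈ box b k ↔ x ∈ box 0 k := by
    intro x k
    conv_lhs => rw [← hφ0]
    exact reflect_mem_box x 0 k
  set p' := φ.symm p with hp'
  have hpp : φ p' = p := by simp [hp']
  have hp0 : ∀ i, 0 ≤ p' i := hσp
  have hp1 : ∀ i, p' i ≤ r + r / 10 := by
    rw [← hpp, hbox] at hp
    intro i
    have := hp i
    simp only [Pi.zero_apply, sub_zero, abs_le] at this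
    have := this.2
    push_cast at this
    exact this
  obtain ⟨q, hq⟩ : ∃ q, q = r / 10 := ⟨_, rfl⟩
  obtain ⟨l, hl⟩ : ∃ l, l = r / 2 := ⟨_, rfl⟩
  have hqZ : (r : ℤ) / 10 = q := by rw [hq]; push_cast; rfl
  simp only [hqZ] at hp1
  rw [← hq] at hX
  -- After reflection p' has nonnegative coordinates. On the two base triangles any two coordinates
  -- sum to at most about 2(r + 2q) - l ≤ 2r, which is inside the dodecahedron. The point p' lies on
  -- layer t = 2l - 3q, each coordinate exceeding γ by l - q; this is about q / 2 more than (t + 1)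
  -- / 2, leaving room for D ≤ q / 10.
  set γ : Z3 := fun i => p' i + q - l with hγ
  set s₀ : ℤ := ∑ i, γ i + l with hs₀
  set A' := A * (K + 12) ^ r with hA'
  have hAA' : A ≤ A' := le_mul_of_one_le_right hA (one_le_pow₀ (by linarith))
  set v : Z3 → ℝ := fun x => u (φ x) with hv
  have hIcc : ∀ x ∈ Set.Icc γ (fun i => γ i + l), φ x ∈ box b (3 * r) := by
    intro x hx
    rw [hbox]
    intro i
    have a1 := hx.1 i
    have a2 := hx.2 i
    have a3 := hp0 i
    have a4 := hp1 i
    simp only [hγ] at a1 a2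
    rw [Pi.zero_apply, sub_zero, abs_le]
    lia
  have hdod : ∀ x : Z3, (∀ i j, i ≠ j → |x i| + |x j| ≤ 2 * r) → |v x| ≤ A' := by
    intro x hx
    refine small_on_dodecahedron u V K A hK b r
      (fun y hy => heq y (box_mono (by lia) hy)) (fun y hy => hV y (box_mono (by lia) hy)) hs _ ?_
    intro i j hij
    have habs : ∀ i, |φ x i - b i| = |x i| := by
      intro i
      rw [hφ, reflect_apply, add_sub_cancel_left, abs_mul]
      rcases sign_eq hσ i with h | h <;> simp [h]
    rw [habs, habs]
    exact hx i j hij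
  have hbase : ∀ s : ℤ, s ≤ s₀ → ∀ x ∈ tri γ s, |v x| ≤ A' := by
    intro s hs x hx
    refine hdod x ?_
    have key : ∀ i j, i ≠ j → |x i| + |x j| ≤ 2 * r := by
      intro i j hij
      have hi := hx.1 i
      have hj := hx.1 j
      have pi0 := hp0 i
      have pi1 := hp1 i
      have pj0 := hp0 j
      have pj1 := hp1 j
      have hsum : (x i - γ i) + (x j - γ j) ≤ l := by
        have a0 := hx.1 i
        have a1 := hx.1 (i + 1)
        have a2 := hx.1 (i + 2)
        have a3 := hx.2
        rw [sum_fin3 _ i] at a3 hs₀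
        rcases fin3_cases i j with rfl | rfl | rfl
        · exact absurd rfl hij
        · lia
        · lia
      simp only [hγ] at hi hj hsum
      rcases abs_cases (x i) with h | h <;> rcases abs_cases (x j) with h' | h' <;>
        rw [h.1, h'.1] <;> lia
    exact key
  have hl0 : 0 < r := by lia
  obtain ⟨D, hD, hDt, -⟩ := small_in_tetrahedron M hM v (fun x => V (φ x)) K A' hK (φ ⁻¹' E)
    (X.map φ.symm.toEmbedding) γ s₀ l q r hs₀ (by lia) (by lia)
    (fun x hx => by
      rw [hv, hφ, laplacian_reflect]
      exact heq _ (hIcc x hx))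
    (fun x hx => hV _ (hIcc x hx)) (hbase s₀ le_rfl) (hbase (s₀ - 1) (by lia))
    (fun x hx => by
      rcases hsm _ (hIcc x hx) with h | h | h
      · exact Or.inl (h.trans hAA')
      · exact Or.inr (Or.inl h)
      · exact Or.inr (Or.inr (mem_map.2 ⟨φ x, h, by simp⟩)))
    (fun x w n hw hn hseg => by
      refine le_trans (Nat.mul_le_mul_left 2 (segCount_mono (T := φ ⁻¹' {y | ¬ Thin M E y r}) ?_
        x w n)) ?_
      · intro y hy hcon
        exact hy hcon.reflect
      · rw [hφ, segCount_reflect]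
        refine hthin _ _ n (isStep_mul hσ hw) (by lia) fun k hk => ?_
        rw [← reflect_add_smul]
        exact hIcc _ (hseg k hk))
    (by rwa [card_map]) (2 * l - 3 * q) (by lia)
  have hDq : 10 * D ≤ q := by
    have h2 : #{x ∈ X.map φ.symm.toEmbedding | ∑ i, x i ≤ s₀ + (2 * l - 3 * q : ℕ)} ≤ #X := by
      rw [← card_map φ.symm.toEmbedding (s := X)]
      exact card_le_card (filter_subset _ _)
    have hMX : 1000 * #X ≤ 45000 * M ^ 2 * #X := Nat.mul_le_mul_right _ (by nlinarith)
    by_contra hcon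
    have h3 : q * q < 10 * D * q := Nat.mul_lt_mul_of_pos_right (by lia) (by lia)
    nlinarith
  have hfin := hDt p' ⟨fun i => by simp only [hγ]; lia, by
    rw [hs₀, Fin.sum_univ_three, Fin.sum_univ_three]
    simp only [hγ]
    lia⟩
  rw [hv] at hfin
  simp only [hpp] at hfin
  refine hfin.trans ?_
  rw [hA', mul_assoc]
  refine mul_le_mul_of_nonneg_left ?_ hA
  have hK1 : (1 : ℝ) ≤ K + 12 := by linarith
  calc (K + 12) ^ r * ((K + 9) * 2 ^ (3000 * l ^ 2)) ^ (2 * l - 3 * q)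
      ≤ (K + 12) ^ r * ((K + 12) * 2 ^ (3000 * l ^ 2)) ^ r := by
        have h1 : (1 : ℝ) ≤ (K + 12) * 2 ^ (3000 * l ^ 2) :=
          one_le_mul_of_one_le_of_one_le hK1 (one_le_pow₀ (by norm_num))
        gcongr
        refine (pow_le_pow_left₀ (by positivity) ?_ _).trans (pow_le_pow_right₀ h1 ?_)
        · gcongr
          linarith
        · lia
    _ = (K + 12) ^ (2 * r) * 2 ^ (3000 * l ^ 2 * r) := by
        rw [mul_pow, ← pow_mul, ← mul_assoc, ← pow_add]
        congr 2
        ring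
    _ ≤ (K + 12) ^ r ^ 3 * 2 ^ (3000 * r ^ 3) := by
        have h2 : 2 * r ≤ r ^ 3 := by
          have : 2 ≤ r := by lia
          nlinarith [Nat.mul_le_mul this this]
        have h3 : 3000 * l ^ 2 * r ≤ 3000 * r ^ 3 := by
          have : l ^ 2 ≤ r ^ 2 := Nat.pow_le_pow_left (by lia) 2
          calc 3000 * l ^ 2 * r ≤ 3000 * r ^ 2 * r := by gcongr
            _ = 3000 * r ^ 3 := by ring
        exact mul_le_mul (pow_le_pow_right₀ hK1 h2) (pow_le_pow_right₀ (by norm_num) h3)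
          (by positivity) (by positivity)
    _ = ((K + 12) * 2 ^ 3000) ^ r ^ 3 := by rw [mul_pow, ← pow_mul]

/-! ### Growing cubes from a good centre to the origin. -/

/-- Near `b`, at all scales between `M₁` and `R`, at least half of the points of each long lattice
segment are thin points for `E`; and `E` has at most one point in the vicinity of `b` of
scale `M₁`. -/
def ThinAround (M₁ M : ℕ) (E : Set Z3) (b : Z3) (R : ℕ) : Prop :=
  (∀ x ∈ E, ∀ y ∈ E, x ∈ box b (10 * M₁) → y ∈ box b (10 * M₁) → x = y) ∧
  ∀ r : ℕ, M₁ ≤ r → r ≤ R → ∀ (x v : Z3) (n : ℕ), IsStep v → r ≤ 100 * n →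
    (∀ k < n, x + (k : ℤ) • v ∈ box b (3 * r)) → 2 * segCount {y | ¬ Thin M E y r} x v n ≤ n

open Classical in
-- At scale M₁ the density bound empties `X` and at most one point of `E` remains, recovered from
-- the equation at a neighbour. Afterwards `grow_box` is iterated from r₀ = r - r / 20; since r₀ ≤
-- 39r / 40, the exponents satisfy 20r₀³ + r₀³ ≤ 20r³.
theorem small_near_thinAround_point (M M₁ : ℕ) (hM : 10 ≤ M) (hM₁ : 10000 * M ≤ M₁)
    (u V : Z3 → ℝ) (K A : ℝ) (hK : 0 ≤ K) (hA : 0 ≤ A) (E : Set Z3) (X : Finset Z3) (b : Z3) (R : ℕ)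
    (hthin : ThinAround M₁ M E b R)
    (heq : ∀ x ∈ box b (3 * R), laplacian u x = V x * u x) (hV : ∀ x ∈ box b (3 * R), |V x| ≤ K)
    (hsm : ∀ x ∈ box b (3 * R), |u x| ≤ A ∨ x ∈ E ∨ x ∈ X)
    (hX : ∀ r : ℕ, M₁ ≤ r → #{x ∈ X | x ∈ box b (3 * r)} * M₁ ^ 2 < r ^ 2) (r : ℕ) :
    M₁ ≤ r → r ≤ R → ∀ x ∈ box b r, |u x| ≤ A * ((K + 12) * 2 ^ 3000) ^ (20 * r ^ 3) := by
  have hB : (1 : ℝ) ≤ (K + 12) * 2 ^ 3000 :=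
    one_le_mul_of_one_le_of_one_le (by linarith) (one_le_pow₀ (by norm_num))
  have hB11 : K + 11 ≤ (K + 12) * 2 ^ 3000 := by
    have : (1 : ℝ) ≤ 2 ^ 3000 := one_le_pow₀ (by norm_num)
    calc K + 11 ≤ (K + 12) * 1 := by linarith
      _ ≤ _ := by gcongr
  generalize hBB : (K + 12) * 2 ^ 3000 = B at *
  induction r using Nat.strong_induction_on with
  | _ r ih =>
  intro hr hrR x hx
  by_cases hr2 : r < 2 * M₁
  · have hXM : {x ∈ X | x ∈ box b (3 * M₁)} = ∅ := by
      have := hX M₁ le_rfl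
      rw [← card_eq_zero]
      by_contra hcon
      have h1 : 1 ≤ #{x ∈ X | x ∈ box b (3 * M₁)} := by lia
      have h2 := Nat.mul_le_mul_right (M₁ ^ 2) h1
      lia
    have hbase : ∀ y ∈ box b (2 * M₁ + 2), |u y| ≤ A ∨ y ∈ E := by
      intro y hy
      have h2 : y ∉ X := by
        intro hyX
        have : y ∈ {x ∈ X | x ∈ box b (3 * M₁)} :=
          mem_filter.2 ⟨hyX, box_mono (by lia) hy⟩
        rw [hXM] at this
        simp at this
      have h3 := hsm y (box_mono (by lia) hy)
      tauto
    have hone : A * B ≤ A * B ^ (20 * r ^ 3) := by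
      refine mul_le_mul_of_nonneg_left (le_self_pow₀ hB ?_) hA
      have : 0 < r := by lia
      positivity
    refine le_trans ?_ hone
    have hx2 : x ∈ box b (2 * M₁) := box_mono (by lia) hx
    rcases hbase x (box_mono (by lia) hx2) with h | hxE
    · exact h.trans (le_mul_of_one_le_right hA hB)
    have hother : ∀ w : Z3, w ≠ 0 → (∀ i, |w i| ≤ 2) → |u (x + w)| ≤ A := by
      intro w hw0 hw
      have hmem : x + w ∈ box b (2 * M₁ + 2) := by
        intro i
        have h1 := hx2 i
        have h2 := hw i
        rw [abs_le] at *
        simp only [Pi.add_apply]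
        lia
      rcases hbase _ hmem with h | h
      · exact h
      · have := hthin.1 _ hxE _ h (box_mono (by lia) hx2) (box_mono (by lia) hmem)
        exact absurd (by simpa using this) hw0
    have hy : x + Pi.single 0 1 ∈ box b (3 * R) := by
      intro i
      have h1 := hx2 i
      rw [abs_le] at *
      simp only [Pi.add_apply, Pi.single_apply]
      split_ifs <;> lia
    have key := abs_neighbour_le u V K A (x + Pi.single 0 1) (heq _ hy) (hV _ hy) 0 (-1)
      (Or.inr rfl) (hother _ (by simp) (fun i => by fin_cases i <;> simp)) (by
        rw [Pi.single_neg, sub_neg_eq_add, add_assoc]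
        refine hother _ ?_ fun i => ?_
        · intro h
          have := congrFun h 0
          simp at this
        · fin_cases i <;> simp) (by
        intro j hj
        constructor
        · rw [add_assoc]
          refine hother _ ?_ fun i => ?_
          · intro h
            have := congrFun h 0
            simp [hj.symm] at this
          · simp only [Pi.add_apply, Pi.single_apply]
            split_ifs <;> simp
        · rw [add_sub_assoc]
          refine hother _ ?_ fun i => ?_
          · intro h
            have := congrFun h 0
            simp [hj.symm] at this
          · simp only [Pi.sub_apply, Pi.single_apply]
            split_ifs <;> simp)
    rw [Pi.single_neg, add_neg_cancel_right] at key
    calc |u x| ≤ (K + 11) * A := key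
      _ = A * (K + 11) := mul_comm _ _
      _ ≤ A * B := by gcongr
  · obtain ⟨r₀, hr₀⟩ : ∃ r₀, r₀ = r - r / 20 := ⟨_, rfl⟩
    have hi := ih r₀ (by lia) (by lia) (by lia)
    have hAA : A ≤ A * B ^ (20 * r₀ ^ 3) := le_mul_of_one_le_right hA (one_le_pow₀ hB)
    have hstep := grow_box M hM u V K (A * B ^ (20 * r₀ ^ 3)) hK E {x ∈ X | x ∈ box b (3 * r₀)} b r₀
      (by lia) (fun y hy => heq y (box_mono (by lia) hy)) (fun y hy => hV y (box_mono (by lia) hy))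
      hi
      (by
        intro y hy
        rcases hsm y (box_mono (by lia) hy) with h | h | h
        · exact Or.inl (h.trans hAA)
        · exact Or.inr (Or.inl h)
        · exact Or.inr (Or.inr (mem_filter.2 ⟨h, hy⟩)))
      (hthin.2 r₀ (by lia) (by lia))
      (by
        have h1 := hX r₀ (by lia)
        have h2 : (10000 * M) ^ 2 ≤ M₁ ^ 2 := Nat.pow_le_pow_left hM₁ 2
        have h3 := Nat.mul_le_mul_left #{x ∈ X | x ∈ box b (3 * r₀)} h2
        have h4 : r₀ ≤ 11 * (r₀ / 10) := by lia
        have h5 := Nat.pow_le_pow_left h4 2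
        nlinarith)
    rw [hBB] at hstep
    refine (hstep x (box_mono ?_ hx)).trans ?_
    · push_cast
      lia
    · rw [mul_assoc, ← pow_add]
      refine mul_le_mul_of_nonneg_left (pow_le_pow_right₀ hB ?_) hA
      have h1 : 40 * r₀ ≤ 39 * r := by lia
      have h2 := Nat.pow_le_pow_left h1 3
      rw [mul_pow, mul_pow] at h2
      lia

open Classical in
-- At least half the points of the square of radius R in the plane x₂ = 0 are admissible centres,
-- and the covering argument yields one near which `X` is sparse at every scale from M₁ up. Its cube
-- of radius R contains the origin.
theorem abs_zero_le_of_few_large (M M₁ : ℕ) (hM : 10 ≤ M) (hM₁ : 10000 * M ≤ M₁)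
    (u V : Z3 → ℝ) (K A : ℝ) (hK : 0 ≤ K) (hA : 0 ≤ A) (E : Set Z3) (X : Finset Z3) (R : ℕ)
    (hR : M₁ ≤ R)
    (heq : ∀ x ∈ box 0 (4 * R), laplacian u x = V x * u x) (hV : ∀ x ∈ box 0 (4 * R), |V x| ≤ K)
    (hsm : ∀ x ∈ box 0 (4 * R), |u x| ≤ A ∨ x ∈ E ∨ x ∈ X)
    (hthin : ∀ y : ℤ, |y| ≤ R → 2 * segCount {x | ¬ ThinAround M₁ M E x R}
      (cyc 0 (-R) y 0) (cyc 0 1 0 0) (2 * R + 1) ≤ 2 * R + 1)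
    (hX : 200 * M₁ ^ 2 * #X < R ^ 2) :
    |u 0| ≤ A * ((K + 12) * 2 ^ 3000) ^ (20 * R ^ 3) := by
  let pt : ℤ → ℕ → Z3 := fun y k => cyc 0 (-R + k) y 0
  set S := (Icc (-R : ℤ) R).sigma fun y => (range (2 * R + 1)).filter fun k =>
    ThinAround M₁ M E (pt y k) R with hS
  set P := S.image fun p => pt p.1 p.2 with hP
  have hinj : ∀ (y y' : ℤ) (k k' : ℕ), pt y k = pt y' k' → y = y' ∧ k = k' := by
    intro y y' k k' h
    have h0 := congrFun h 0
    have h1 := congrFun h 1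
    have e : ∀ a b c, cyc 0 a b c 1 = b := fun a b c => cyc_one 0 a b c
    simp only [pt, cyc_zero, e] at h0 h1
    exact ⟨h1, by lia⟩
  have hcardP : (2 * R + 1) * (2 * R + 1) ≤ 2 * #P := by
    rw [hP, card_image_of_injOn (by
      rintro ⟨j, k⟩ _ ⟨j', k'⟩ _ h
      obtain ⟨rfl, rfl⟩ := hinj _ _ _ _ h
      rfl), hS, card_sigma, mul_sum]
    have hI : #(Icc (-R : ℤ) R) = 2 * R + 1 := by
      rw [Int.card_Icc]
      lia
    calc (2 * R + 1) * (2 * R + 1) = ∑ j ∈ Icc (-R : ℤ) R, (2 * R + 1) := by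
          rw [sum_const, hI, smul_eq_mul]
      _ ≤ _ := by
        refine sum_le_sum fun y hy => ?_
        rw [mem_Icc] at hy
        have e : ∀ k : ℕ, cyc 0 (-R) y 0 + (k : ℤ) • cyc 0 1 0 0 = pt y k := by
          intro k
          funext t
          fin_cases t <;> simp [pt, cyc]
        have h1 := hthin y (abs_le.2 hy)
        rw [segCount] at h1
        simp only [e, Set.mem_ofPred_eq] at h1
        have h2 := card_filter_add_card_filter_not (s := range (2 * R + 1))
          (fun k => ThinAround M₁ M E (pt y k) R)
        rw [card_range] at h2
        lia
  have hPmem : ∀ b ∈ P, ThinAround M₁ M E b R ∧ b ∈ box 0 R ∧ b 2 = 0 := by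
    intro b hb
    obtain ⟨⟨y, k⟩, hjk, rfl⟩ := mem_image.1 hb
    rw [hS, mem_sigma, mem_filter, mem_Icc, mem_range] at hjk
    refine ⟨hjk.2.2, fun i => ?_, cyc_two 0 _ _ _⟩
    have h1 := hjk.1
    have h2 := hjk.2.1
    simp only at h1 h2
    rw [abs_le]
    rcases fin3_cases 0 i with rfl | rfl | rfl
    · simp only [pt, cyc_zero, Pi.zero_apply]
      lia
    · simp only [pt, cyc_one, Pi.zero_apply]
      lia
    · simp only [pt, cyc_two, Pi.zero_apply]
      lia
  obtain ⟨b, hb, hdens⟩ : ∃ b ∈ P, ∀ r : ℕ, M₁ ≤ r →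
      #{x ∈ X | x ∈ box b (3 * r)} * M₁ ^ 2 < r ^ 2 := by
    by_contra hcon
    push Not at hcon
    have hM₁' : (0 : ℝ) < M₁ := by
      have : 0 < M₁ := by lia
      exact_mod_cast this
    have key := card_le_of_dense_boxes X (1 / (9 * (M₁ : ℝ) ^ 2)) (by positivity) P (by
      intro x hx y hy h0 h1
      have hx' := (hPmem x hx).2.2
      have hy' := (hPmem y hy).2.2
      funext t
      rcases fin3_cases 0 t with rfl | rfl | rfl
      · exact h0
      · exact h1
      · exact hx'.trans hy'.symm) (by
      intro b hb
      obtain ⟨r, h1, h2⟩ := hcon b hb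
      refine ⟨3 * r, by lia, ?_⟩
      push_cast
      have h3 : (r : ℝ) ^ 2 ≤ #{x ∈ X | x ∈ box b (3 * r)} * (M₁ : ℝ) ^ 2 := by exact_mod_cast h2
      rw [div_mul_eq_mul_div, div_le_iff₀ (by positivity)]
      nlinarith)
    have h1 : (2 * (R : ℝ) + 1) * (2 * R + 1) ≤ 2 * #P := by exact_mod_cast hcardP
    have h2 : 200 * (M₁ : ℝ) ^ 2 * #X < R ^ 2 := by exact_mod_cast hX
    rw [div_mul_eq_mul_div, div_le_iff₀ (by positivity)] at key
    have : (0 : ℝ) ≤ R := by positivity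
    nlinarith
  obtain ⟨hbt, hb0, -⟩ := hPmem b hb
  have hsub : box b (3 * R) ⊆ box 0 (4 * R) := by
    intro x hx i
    have h1 := hx i
    have h2 := hb0 i
    simp only [Pi.zero_apply, sub_zero, abs_le] at *
    lia
  refine small_near_thinAround_point M M₁ hM hM₁ u V K A hK hA E X b R hbt
    (fun x hx => heq x (hsub hx)) (fun x hx => hV x (hsub hx)) (fun x hx => hsm x (hsub hx)) hdens
    R hR le_rfl 0 fun i => ?_
  have h2 := hb0 i
  simp only [Pi.zero_apply, sub_zero, zero_sub, abs_neg] at *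
  exact h2

/-! ### Density of graded sets along lattice segments. -/

theorem card_le_of_clusters (S : Finset ℕ) (n w p : ℕ) (hS : ∀ k ∈ S, k < n) (hw : 0 < w)
    (h : ∀ k ∈ S, ∀ k' ∈ S, k ≤ k' → k' < k + w → k' ≤ k + p) : #S ≤ (n / w + 1) * (p + 1) := by
  have h1 := card_le_mul_card_image (f := fun k => k / w) S (p + 1) (by
    intro a ha
    set T := {x ∈ S | x / w = a} with hT
    rcases T.eq_empty_or_nonempty with he | hne
    · rw [he]
      simp
    · have hm := T.min'_mem hne
      have hsub : T ⊆ Icc (T.min' hne) (T.min' hne + p) := by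
        intro k hk
        have hle := T.min'_le k hk
        obtain ⟨hm1, hm2⟩ := mem_filter.1 hm
        obtain ⟨hk1, hk2⟩ := mem_filter.1 hk
        rw [mem_Icc]
        refine ⟨hle, h _ hm1 _ hk1 hle ?_⟩
        have e1 := Nat.div_add_mod (T.min' hne) w
        have e2 := Nat.div_add_mod k w
        have e3 := Nat.mod_lt k hw
        rw [hm2] at e1
        rw [hk2] at e2
        lia
      refine (card_le_card hsub).trans (le_of_eq ?_)
      rw [Nat.card_Icc]
      lia)
  have h2 : #(S.image fun k => k / w) ≤ n / w + 1 := by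
    rw [← card_range (n / w + 1)]
    refine card_le_card fun a ha => ?_
    obtain ⟨k, hk, rfl⟩ := mem_image.1 ha
    rw [mem_range]
    exact Nat.lt_succ_of_le (Nat.div_le_div_right (hS k hk).le)
  calc #S ≤ (p + 1) * #(S.image fun k => k / w) := h1
    _ ≤ (p + 1) * (n / w + 1) := Nat.mul_le_mul_left _ h2
    _ = _ := mul_comm _ _

theorem abs_sub_le_dist_toR3 (x y : Z3) (i : Fin 3) : |((x i - y i : ℤ) : ℝ)| ≤ dist (toR3 x) (toR3 y) := by
  have h := PiLp.norm_apply_le (toR3 x - toR3 y) i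
  rw [dist_eq_norm]
  simpa [toR3] using h

theorem dist_toR3_le (x y : Z3) (m : ℝ) (hm : 0 ≤ m) (h : ∀ i, |((x i - y i : ℤ) : ℝ)| ≤ m) :
    dist (toR3 x) (toR3 y) ≤ 2 * m := by
  rw [EuclideanSpace.dist_eq, Real.sqrt_le_left (by positivity)]
  have h' : ∀ i, dist (toR3 x i) (toR3 y i) ^ 2 ≤ m ^ 2 := by
    intro i
    have := h i
    simp only [toR3, Real.dist_eq]
    push_cast at this
    gcongr
  rw [Fin.sum_univ_three]
  nlinarith [h' 0, h' 1, h' 2]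

theorem dist_toR3_le_of_mem_box {b x : Z3} {m : ℕ} (h : x ∈ box b m) :
    dist (toR3 b) (toR3 x) ≤ 2 * m := by
  refine dist_toR3_le _ _ _ (by positivity) fun i => ?_
  have := h i
  rw [abs_sub_comm] at this
  exact_mod_cast this

theorem dist_seg_ge (x v : Z3) (hv : IsStep v) (k k' : ℕ) :
    |(k : ℝ) - k'| ≤ dist (toR3 (x + (k : ℤ) • v)) (toR3 (x + (k' : ℤ) • v)) := by
  obtain ⟨i, hi⟩ : ∃ i, v i ≠ 0 := by
    by_contra hcon
    push Not at hcon
    exact hv.1 (funext hcon)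
  refine le_trans ?_ (abs_sub_le_dist_toR3 _ _ i)
  have h1 : |v i| = 1 := le_antisymm (hv.2 i) (Int.one_le_abs hi)
  have h2 : |((x + (k : ℤ) • v) i - (x + (k' : ℤ) • v) i : ℤ)| = |(k : ℤ) - k'| := by
    have : ((x + (k : ℤ) • v) i - (x + (k' : ℤ) • v) i : ℤ) = ((k : ℤ) - k') * v i := by
      simp
      ring
    rw [this, abs_mul, h1, mul_one]
  have h3 : (|((x + (k : ℤ) • v) i - (x + (k' : ℤ) • v) i : ℤ)| : ℝ) = |(k : ℝ) - k'| := by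
    exact_mod_cast congrArg (fun z : ℤ => (z : ℝ)) h2
  exact h3.ge

theorem dist_seg_le (x v : Z3) (hv : IsStep v) (k k' : ℕ) :
    dist (toR3 (x + (k : ℤ) • v)) (toR3 (x + (k' : ℤ) • v)) ≤ 2 * |(k : ℝ) - k'| := by
  refine dist_toR3_le _ _ _ (abs_nonneg _) fun i => ?_
  have h1 : |((v i : ℤ) : ℝ)| ≤ 1 := by exact_mod_cast hv.2 i
  have h2 : (((x + (k : ℤ) • v) i - (x + (k' : ℤ) • v) i : ℤ) : ℝ) = ((k : ℝ) - k') * v i := by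
    simp
    ring
  rw [h2, abs_mul]
  exact mul_le_of_le_one_right (abs_nonneg _) h1

/-- The lattice points at distance less than `ρ` from one of the points `c j t`. -/
def near {N : ℕ} (c : ℕ → Fin N → R3) (ρ : ℝ) : Set Z3 :=
  {x | ∃ t j, dist (toR3 x) (c j t) < ρ}

theorem segCount_le_sum {ι : Type*} [Fintype ι] (S : Set Z3) (T : ι → Set Z3) (x v : Z3) (n : ℕ)
    (h : ∀ k < n, x + (k : ℤ) • v ∈ S → ∃ i, x + (k : ℤ) • v ∈ T i) :
    segCount S x v n ≤ ∑ i, segCount (T i) x v n := by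
  classical
  refine le_trans (card_le_card fun k hk => ?_) card_biUnion_le
  obtain ⟨h1, h2⟩ := mem_filter.1 hk
  obtain ⟨i, hi⟩ := h k (mem_range.1 h1) h2
  exact mem_biUnion.2 ⟨i, mem_univ _, mem_filter.2 ⟨h1, hi⟩⟩

/-- For one sequence of centres, a window of z / 4 steps is too short to meet two balls, and one
ball occupies a span of at most 4zδ steps. With O(n / z) windows the density is O(δ) per sequence.
-/
theorem segCount_near_le {N : ℕ} (c : ℕ → Fin N → R3) (z δ ρ : ℝ) (hz : 16 ≤ z) (hδ : δ ≤ 1 / 8)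
    (hzδ : 1 ≤ z * δ) (hρ : ρ ≤ 2 * (z * δ))
    (hsep : ∀ t j j', j ≠ j' → z ≤ dist (c j t) (c j' t))
    (x v : Z3) (n : ℕ) (hv : IsStep v) (hn : z ≤ 10000 * n) :
    (segCount (near c ρ) x v n : ℝ) ≤ 60000 * N * δ * n := by
  classical
  have h1 := segCount_le_sum (near c ρ) (fun t : Fin N => {x | ∃ j, dist (toR3 x) (c j t) < ρ})
    x v n fun k _ hk => hk
  have hδ0 : 0 < δ := by
    by_contra hcon
    push Not at hcon
    nlinarith
  have hn0 : (0 : ℝ) ≤ n := by positivity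
  set w := ⌊z / 4⌋₊ with hw
  set p := ⌊4 * (z * δ)⌋₊ with hp
  have hw4 : 4 ≤ w := Nat.le_floor (by push_cast; linarith)
  have hwz : (w : ℝ) ≤ z / 4 := Nat.floor_le (by linarith)
  have hwz' : z / 8 ≤ w := by
    have := Nat.lt_floor_add_one (z / 4)
    linarith
  have h2 : ∀ t : Fin N, segCount {x | ∃ j, dist (toR3 x) (c j t) < ρ} x v n ≤
      (n / w + 1) * (p + 1) := by
    intro t
    refine card_le_of_clusters _ n w p (fun k hk => mem_range.1 (mem_filter.1 hk).1) (by lia) ?_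
    intro k hk k' hk' hkk hkw
    obtain ⟨-, j, hj⟩ := mem_filter.1 hk
    obtain ⟨-, j', hj'⟩ := mem_filter.1 hk'
    have habs : |(k : ℝ) - k'| = k' - k := by
      rw [abs_sub_comm, abs_of_nonneg]
      have : (k : ℝ) ≤ k' := by exact_mod_cast hkk
      linarith
    have hge := dist_seg_ge x v hv k k'
    have hle := dist_seg_le x v hv k k'
    rw [habs] at hge hle
    have hjj : j = j' := by
      by_contra hne
      have h3 := hsep t j j' hne
      have h4 := dist_triangle4_right (c j t) (c j' t) (toR3 (x + (k : ℤ) • v))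
        (toR3 (x + (k' : ℤ) • v))
      rw [dist_comm (c j t) (toR3 _), dist_comm (c j' t) (toR3 _)] at h4
      have h5 : (k' : ℝ) < k + w := by exact_mod_cast hkw
      have h6 : z * δ ≤ z * (1 / 8) := mul_le_mul_of_nonneg_left hδ (by linarith)
      linarith
    subst hjj
    have h3 := dist_triangle_right (toR3 (x + (k : ℤ) • v)) (toR3 (x + (k' : ℤ) • v)) (c j t)
    have h4 : (k' : ℝ) - k ≤ 4 * (z * δ) := by linarith
    have h5 : k' - k ≤ p := by
      refine Nat.le_floor ?_
      rwa [Nat.cast_sub hkk]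
    lia
  have h3 : (segCount (near c ρ) x v n : ℝ) ≤ N * ((n / w + 1) * (p + 1)) := by
    have h4 : segCount (near c ρ) x v n ≤ N * ((n / w + 1) * (p + 1)) := by
      refine h1.trans ((sum_le_sum fun t _ => h2 t).trans (le_of_eq ?_))
      simp
    have h5 : (segCount (near c ρ) x v n : ℝ) ≤ N * ((((n / w : ℕ) : ℝ) + 1) * (p + 1)) := by
      exact_mod_cast h4
    refine h5.trans ?_
    gcongr
    exact Nat.cast_div_le
  refine h3.trans ?_
  have h6 : (n : ℝ) / w + 1 ≤ 10008 * n / z := by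
    have h7 : (n : ℝ) / w ≤ 8 * n / z := by
      rw [div_le_div_iff₀ (by linarith) (by linarith)]
      nlinarith
    have h8 : 1 ≤ 10000 * n / z := by
      rw [le_div_iff₀ (by linarith)]
      linarith
    calc (n : ℝ) / w + 1 ≤ 8 * n / z + 10000 * n / z := add_le_add h7 h8
      _ = _ := by ring
  have h7 : (p : ℝ) + 1 ≤ 5 * (z * δ) := by
    have := Nat.floor_le (a := 4 * (z * δ)) (by linarith)
    linarith
  have hz0 : z ≠ 0 := by linarith
  calc (N : ℝ) * ((n / w + 1) * (p + 1)) ≤ N * ((10008 * n / z) * (5 * (z * δ))) := by gcongr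
    _ = 50040 * N * δ * n := by field_simp; ring
    _ ≤ 60000 * N * δ * n := by gcongr; norm_num

/-- A lattice form of graded sets: `E` is contained in a sparse set of isolated points, together
with balls of large radii around families of separated centres. -/
structure IsLatticeGraded {d N : ℕ} (ε : ℝ) (l : Fin d → ℝ) (c : Fin d → ℕ → Fin N → R3)
    (c₀ : ℕ → Z3) (I : Set (Fin d)) (E : Set Z3) : Prop where
  ε_pos : 0 < ε
  ε_lt : ε < 1 / 10 ^ 10
  large : ∀ i, 10 ^ 11 ≤ l i
  decay : ∀ i, l i ^ (-(ε / 4)) ≤ 1 / 8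
  sum_le : ∑ i, 60000 * N * l i ^ (-(ε / 4)) ≤ 1 / 4000
  sep : ∀ i t j j', j ≠ j' → l i ^ (1 + ε) ≤ dist (c i j t) (c i j' t)
  sep₀ : ∀ j j', j ≠ j' → ε⁻¹ ≤ dist (toR3 (c₀ j)) (toR3 (c₀ j'))
  cover : ∀ x ∈ E, (∃ j, x = c₀ j) ∨ ∃ i ∈ I, x ∈ near (c i) (l i)

namespace IsLatticeGraded

variable {d N : ℕ} {ε : ℝ} {l : Fin d → ℝ} {c : Fin d → ℕ → Fin N → R3} {c₀ : ℕ → Z3}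
  {I : Set (Fin d)} {E : Set Z3}

theorem one_le (h : IsLatticeGraded ε l c c₀ I E) (i : Fin d) : 1 ≤ l i :=
  le_trans (by norm_num) (h.large i)

theorem le_rpow (h : IsLatticeGraded ε l c c₀ I E) (i : Fin d) {θ : ℝ} (hθ : 0 ≤ θ) :
    l i ≤ l i ^ (1 + θ) := by
  conv_lhs => rw [← Real.rpow_one (l i)]
  exact Real.rpow_le_rpow_of_exponent_le (h.one_le i) (by linarith)

/-- Only separation l^(1+θ+ε/4) is used, so the relative radius is l^(-ε/4) for every θ, and
segments of that order of length suffice. The values needed are θ = 0, ε/2 and 3ε/4. -/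
theorem segCount_near (h : IsLatticeGraded ε l c c₀ I E) (i : Fin d) (θ : ℝ) (hθ : 0 ≤ θ)
    (hθ' : θ ≤ 3 * ε / 4) (x v : Z3) (n : ℕ) (hv : IsStep v)
    (hn : l i ^ (1 + (θ + ε / 4)) ≤ 10000 * n) :
    (segCount (near (c i) (2 * l i ^ (1 + θ))) x v n : ℝ) ≤
      60000 * N * l i ^ (-(ε / 4)) * n := by
  have hε := h.ε_pos
  have hl := h.large i
  have h1 := h.one_le i
  have hmul : l i ^ (1 + (θ + ε / 4)) * l i ^ (-(ε / 4)) = l i ^ (1 + θ) := by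
    rw [← Real.rpow_add (by linarith)]
    congr 1
    ring
  refine segCount_near_le (c i) (l i ^ (1 + (θ + ε / 4))) _ _ ?_ (h.decay i) ?_ ?_ ?_ x v n hv hn
  · have := h.le_rpow i (θ := θ + ε / 4) (by linarith)
    have : (16 : ℝ) ≤ 10 ^ 11 := by norm_num
    linarith
  · rw [hmul]
    exact Real.one_le_rpow h1 (by linarith)
  · rw [hmul]
  · intro t j j' hj
    exact (Real.rpow_le_rpow_of_exponent_le h1 (by linarith)).trans (h.sep i t j j' hj)

/-- A ball that is met from outside its enlargement must be small compared with the distance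
travelled. This makes segments at the current scale long enough for `segCount_near`. -/
theorem rpow_le_of_near (h : IsLatticeGraded ε l c c₀ I E) (i : Fin d) (θ : ℝ) (hθ : 0 ≤ θ)
    (b x : Z3) (m : ℕ) (hb : b ∉ near (c i) (2 * l i ^ (1 + θ))) (hx : x ∈ near (c i) (l i))
    (hxb : x ∈ box b m) : l i ^ (1 + θ) ≤ 2 * m := by
  obtain ⟨t, j, hj⟩ := hx
  have h1 : 2 * l i ^ (1 + θ) ≤ dist (toR3 b) (c i j t) := by
    by_contra hcon
    push Not at hcon
    exact hb ⟨t, j, hcon⟩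
  have h2 := dist_toR3_le_of_mem_box hxb
  have h3 := dist_triangle (toR3 b) (toR3 x) (c i j t)
  have h4 := h.le_rpow i hθ
  linarith

theorem eq_of_mem_box (h : IsLatticeGraded ε l c c₀ I E) (b : Z3) (m : ℕ) (hm : m ≤ 10 ^ 9)
    (hb : ∀ i ∈ I, ∀ x ∈ box b m, x ∉ near (c i) (l i)) :
    ∀ x ∈ E, ∀ y ∈ E, x ∈ box b m → y ∈ box b m → x = y := by
  intro x hx y hy hxb hyb
  obtain ⟨j, rfl⟩ : ∃ j, x = c₀ j := by
    rcases h.cover x hx with h1 | ⟨i, hi, h1⟩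
    · exact h1
    · exact absurd h1 (hb i hi x hxb)
  obtain ⟨j', rfl⟩ : ∃ j, y = c₀ j := by
    rcases h.cover y hy with h1 | ⟨i, hi, h1⟩
    · exact h1
    · exact absurd h1 (hb i hi y hyb)
  by_contra hne
  have h1 := h.sep₀ j j' fun hjj => hne (by rw [hjj])
  have h2 := dist_toR3_le_of_mem_box hxb
  have h3 := dist_toR3_le_of_mem_box hyb
  have h4 := dist_triangle_left (toR3 (c₀ j)) (toR3 (c₀ j')) (toR3 b)
  have h5 : (10 : ℝ) ^ 10 < ε⁻¹ := by
    rw [lt_inv_comm₀ (by norm_num) h.ε_pos]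
    have := h.ε_lt
    rwa [one_div] at this
  have h6 : (m : ℝ) ≤ 10 ^ 9 := by exact_mod_cast hm
  linarith

theorem not_near_of_not_near (h : IsLatticeGraded ε l c c₀ I E) (i : Fin d) (θ : ℝ) (hθ : 0 ≤ θ)
    (b : Z3) (m : ℕ) (hm : m ≤ 10 ^ 9) (hb : b ∉ near (c i) (2 * l i ^ (1 + θ))) :
    ∀ x ∈ box b m, x ∉ near (c i) (l i) := by
  intro x hx hxn
  have h1 := h.rpow_le_of_near i θ hθ b x m hb hxn hx
  have h2 := h.le_rpow i hθ
  have h3 := h.large i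
  have h4 : (m : ℝ) ≤ 10 ^ 9 := by exact_mod_cast hm
  linarith

theorem segCount_centres (h : IsLatticeGraded ε l c c₀ I E) (x v : Z3) (n : ℕ) (hv : IsStep v) :
    segCount {y | ∃ j, y = c₀ j} x v n ≤ n / 10000 + 1 := by
  classical
  have := card_le_of_clusters ((range n).filter fun k : ℕ => x + (k : ℤ) • v ∈ {y | ∃ j, y = c₀ j})
    n 10000 0 (fun k hk => mem_range.1 (mem_filter.1 hk).1) (by norm_num) (by
    intro k hk k' hk' hkk hkw
    by_contra hne
    obtain ⟨-, j, hj⟩ := mem_filter.1 hk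
    obtain ⟨-, j', hj'⟩ := mem_filter.1 hk'
    have habs : |(k : ℝ) - k'| = k' - k := by
      rw [abs_sub_comm, abs_of_nonneg]
      have : (k : ℝ) ≤ k' := by exact_mod_cast hkk
      linarith
    have h1 := dist_seg_ge x v hv k k'
    have h2 := dist_seg_le x v hv k k'
    rw [habs, hj, hj'] at h1 h2
    have h3 : (k' : ℝ) < k + 10000 := by exact_mod_cast hkw
    have h4 : (k : ℝ) + 0 < k' := by exact_mod_cast not_le.1 hne
    have h5 := h.sep₀ j j' fun hjj => by
      rw [hjj, dist_self] at h1
      linarith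
    have h6 : (10 : ℝ) ^ 10 < ε⁻¹ := by
      rw [lt_inv_comm₀ (by norm_num) h.ε_pos]
      have := h.ε_lt
      rwa [one_div] at this
    linarith)
  rw [zero_add, mul_one] at this
  exact this

theorem segCount_le (h : IsLatticeGraded ε l c c₀ I E) (T : Fin d → Set Z3) (S : Set Z3)
    (x v : Z3) (n : ℕ) (hS : ∀ k < n, x + (k : ℤ) • v ∈ S → ∃ i, x + (k : ℤ) • v ∈ T i)
    (hT : ∀ i, (∃ k < n, x + (k : ℤ) • v ∈ T i) →
      (segCount (T i) x v n : ℝ) ≤ 60000 * N * l i ^ (-(ε / 4)) * n) :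
    4000 * segCount S x v n ≤ n := by
  classical
  have h1 := segCount_le_sum S T x v n hS
  have h2 : ∀ i, (segCount (T i) x v n : ℝ) ≤ 60000 * N * l i ^ (-(ε / 4)) * n := by
    intro i
    by_cases hk : ∃ k < n, x + (k : ℤ) • v ∈ T i
    · exact hT i hk
    · have h0 : segCount (T i) x v n = 0 := by
        rw [segCount, card_eq_zero, filter_eq_empty_iff]
        intro k hk1 hk2
        exact hk ⟨k, mem_range.1 hk1, hk2⟩
      rw [h0, Nat.cast_zero]
      have := h.one_le i
      positivity
  have h3 : (segCount S x v n : ℝ) ≤ 1 / 4000 * n := by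
    calc (segCount S x v n : ℝ) ≤ ∑ i, (segCount (T i) x v n : ℝ) := by exact_mod_cast h1
      _ ≤ ∑ i, 60000 * N * l i ^ (-(ε / 4)) * n := sum_le_sum fun i _ => h2 i
      _ = (∑ i, 60000 * N * l i ^ (-(ε / 4))) * n := by rw [sum_mul]
      _ ≤ 1 / 4000 * n := by
        gcongr
        exact h.sum_le
  have h4 : (4000 : ℝ) * segCount S x v n ≤ n := by linarith
  exact_mod_cast h4

/-- Scales whose balls miss the relevant box are harmless even if `b` lies in an enlargement. The
other scales that meet a segment satisfy l^(1+ε/2) ≤ 80ρ, so θ = 0 applies; the isolated points add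
at most n / 10000 + 1. -/
theorem thin (h : IsLatticeGraded ε l c c₀ I E) (b : Z3) (R : ℕ) (hR : 10000 ≤ R)
    (hb : ∀ i ∈ I, b ∈ near (c i) (2 * l i ^ (1 + ε / 2)) →
      ∀ x ∈ box b (40 * R), x ∉ near (c i) (l i)) : Thin 10000 E b R := by
  have hε := h.ε_pos
  refine ⟨?_, ?_⟩
  · refine h.eq_of_mem_box b (10 * 10000) (by norm_num) fun i hi => ?_
    by_cases hbi : b ∈ near (c i) (2 * l i ^ (1 + ε / 2))
    · exact fun x hx => hb i hi hbi x (box_mono (by push_cast; lia) hx)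
    · exact h.not_near_of_not_near i (ε / 2) (by linarith) b _ (by norm_num) hbi
  · intro ρ hρ hρR x v n hv hn hseg
    have h1 := h.segCount_le (fun i => {y | i ∈ I ∧ y ∈ near (c i) (l i)})
      {y | ∃ i ∈ I, y ∈ near (c i) (l i)} x v n (fun k _ hk => hk) (by
        rintro i ⟨k, hk, hiI, hki⟩
        have hbi : b ∉ near (c i) (2 * l i ^ (1 + ε / 2)) := fun hcon =>
          hb i hiI hcon _ (box_mono (by lia) (hseg k hk)) hki
        have h2 := h.rpow_le_of_near i (ε / 2) (by linarith) b _ (40 * ρ) hbi hki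
          (by push_cast; exact hseg k hk)
        have h3 : l i ^ (1 + (0 + ε / 4)) ≤ l i ^ (1 + ε / 2) :=
          Real.rpow_le_rpow_of_exponent_le (h.one_le i) (by linarith)
        have h4 : (ρ : ℝ) ≤ n := by exact_mod_cast hn
        push_cast at h2
        refine le_trans ?_ (h.segCount_near i 0 le_rfl (by linarith) x v n hv (by linarith))
        norm_cast
        refine segCount_mono ?_ x v n
        rintro y ⟨-, t, j, hy⟩
        refine ⟨t, j, hy.trans_le ?_⟩
        have := h.one_le i
        rw [pow_one]
        linarith)
    have h2 := h.segCount_centres x v n hv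
    have h3 := segCount_le_sum E (fun s : Bool => if s then {y | ∃ j, y = c₀ j} else
      {y | ∃ i ∈ I, y ∈ near (c i) (l i)}) x v n (by
        intro k _ hk
        rcases h.cover _ hk with h4 | h4
        · exact ⟨true, by simpa using h4⟩
        · exact ⟨false, by simpa using h4⟩)
    simp only [Fintype.sum_bool, if_true, Bool.false_eq_true, if_false] at h3
    lia

/-- One level up: points that are not thin lie in the θ = ε/2 enlargement of a ball family with a
ball within reach of scale r. As `b` avoids the 3ε/4 enlargements, l^(1+3ε/4) ≤ 86r ≤ 8600n. -/
theorem thinAround (h : IsLatticeGraded ε l c c₀ I E) (b : Z3) (R : ℕ)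
    (hb : ∀ i ∈ I, b ∉ near (c i) (2 * l i ^ (1 + 3 * ε / 4))) :
    ThinAround (10 ^ 8) 10000 E b R := by
  have hε := h.ε_pos
  refine ⟨?_, ?_⟩
  · refine h.eq_of_mem_box b (10 * 10 ^ 8) (by norm_num) fun i hi => ?_
    exact h.not_near_of_not_near i (3 * ε / 4) (by linarith) b _ (by norm_num) (hb i hi)
  · intro r hr hrR x v n hv hn hseg
    have hr' : 10000 ≤ r := le_trans (by norm_num) hr
    have h1 := h.segCount_le (fun i => {y | i ∈ I ∧ y ∈ near (c i) (2 * l i ^ (1 + ε / 2)) ∧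
      ∃ x ∈ box y (40 * r), x ∈ near (c i) (l i)}) {y | ¬ Thin 10000 E y r} x v n (by
        intro k hk hy
        by_contra hcon
        push Not at hcon
        refine hy (h.thin _ r hr' fun i hi h2 y hy hyn => ?_)
        exact hcon i ⟨hi, h2, y, hy, hyn⟩) (by
        rintro i ⟨k, hk, hiI, hki, y, hy, hyn⟩
        have hyb : y ∈ box b (43 * r : ℕ) := by
          intro t
          have a1 := hseg k hk t
          have a2 := hy t
          rw [abs_le] at *
          push_cast
          lia
        have h2 := h.rpow_le_of_near i (3 * ε / 4) (by linarith) b y _ (hb i hiI) hyn hyb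
        have h3 : (r : ℝ) ≤ 100 * n := by exact_mod_cast hn
        push_cast at h2
        refine le_trans ?_ (h.segCount_near i (ε / 2) (by linarith) (by linarith) x v n hv ?_)
        · norm_cast
          exact segCount_mono (fun y hy => hy.2.1) x v n
        · rw [show ε / 2 + ε / 4 = 3 * ε / 4 by ring]
          linarith)
    lia

theorem segCount_not_thinAround (h : IsLatticeGraded ε l c c₀ I E) (R : ℕ) (x v : Z3) (n : ℕ)
    (hv : IsStep v) (hI : ∀ i ∈ I, l i ^ (1 + ε) ≤ 10000 * n) :
    2 * segCount {y | ¬ ThinAround (10 ^ 8) 10000 E y R} x v n ≤ n := by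
  have hε := h.ε_pos
  have h1 := h.segCount_le (fun i => {y | i ∈ I ∧ y ∈ near (c i) (2 * l i ^ (1 + 3 * ε / 4))})
    {y | ¬ ThinAround (10 ^ 8) 10000 E y R} x v n (by
      intro k hk hy
      by_contra hcon
      push Not at hcon
      exact hy (h.thinAround _ R fun i hi h2 => hcon i ⟨hi, h2⟩)) (by
      rintro i ⟨k, hk, hiI, hki⟩
      refine le_trans ?_ (h.segCount_near i (3 * ε / 4) (by linarith) le_rfl x v n hv ?_)
      · norm_cast
        exact segCount_mono (fun y hy => hy.2) x v n
      · rw [show 3 * ε / 4 + ε / 4 = ε by ring]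
        exact hI i hiI)
  lia

end IsLatticeGraded

/-! ### Euclidean graded sets, choice of constants, and conclusion. -/

open Filter

theorem mem_cube_iff (n : ℕ) (x : Z3) : x ∈ cube n 0 ↔ x ∈ box 0 n := by
  refine forall_congr' fun i => ?_
  simp only [Pi.zero_apply, Int.cast_zero, sub_zero]
  exact_mod_cast Iff.rfl

theorem finite_cube (n : ℕ) : (cube n 0).Finite := by
  refine (Set.finite_Icc (fun _ => -(n : ℤ) : Z3) (fun _ => (n : ℤ))).subset fun x hx => ?_
  rw [mem_cube_iff] at hx
  refine ⟨fun i => ?_, fun i => ?_⟩ <;>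
  · have := hx i
    rw [Pi.zero_apply, sub_zero, abs_le] at this
    simp only
    lia

theorem diam_cube_le (n : ℕ) : Metric.diam (toR3 '' cube n 0) ≤ 4 * n := by
  refine Metric.diam_le_of_forall_dist_le (by positivity) ?_
  rintro _ ⟨x, hx, rfl⟩ _ ⟨y, hy, rfl⟩
  rw [mem_cube_iff] at hx hy
  refine (dist_toR3_le x y (2 * n) (by positivity) fun i => ?_).trans (by linarith)
  have h1 := hx i
  have h2 := hy i
  have h3 : |x i - y i| ≤ 2 * n := by
    rw [Pi.zero_apply, sub_zero, abs_le] at *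
    lia
  exact_mod_cast h3

theorem setDist_ball_le (x y : R3) {r : ℝ} (hr : 0 < r) :
    setDist (Metric.ball x r) (Metric.ball y r) ≤ dist x y := by
  refine csInf_le ⟨0, ?_⟩ ⟨x, Metric.mem_ball_self hr, y, Metric.mem_ball_self hr, rfl⟩
  rintro _ ⟨a, -, b, -, rfl⟩
  exact dist_nonneg

theorem eq_of_dist_toR3_lt_one {x y : Z3} (h : dist (toR3 x) (toR3 y) < 1) : x = y := by
  funext i
  have h1 := (abs_sub_le_dist_toR3 x y i).trans_lt h
  have h2 : |x i - y i| < 1 := by exact_mod_cast h1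
  rw [abs_lt] at h2
  lia

theorem exists_scale_bound (ε : ℝ) (hε : 0 < ε) (N : ℕ) : ∃ C : ℝ, 10 ^ 11 ≤ C ∧
    C ^ (-(ε / 4)) ≤ 1 / 8 ∧ 2 ≤ C ^ (ε ^ 2 / 2) ∧ 120000 * N * C ^ (-(ε / 4)) ≤ 1 / 4000 := by
  have h1 := tendsto_rpow_neg_atTop (show 0 < ε / 4 by positivity)
  have h2 : Tendsto (fun C : ℝ => 120000 * (N : ℝ) * C ^ (-(ε / 4))) atTop (nhds 0) := by
    simpa using h1.const_mul (120000 * (N : ℝ))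
  have h3 := tendsto_rpow_atTop (show 0 < ε ^ 2 / 2 by positivity)
  obtain ⟨C, c1, c2, c3, c4⟩ := ((eventually_ge_atTop (10 ^ 11 : ℝ)).and
    ((h1.eventually_le_const (show (0 : ℝ) < 1 / 8 by norm_num)).and
    ((h3.eventually_ge_atTop 2).and
    (h2.eventually_le_const (show (0 : ℝ) < 1 / 4000 by norm_num))))).exists
  exact ⟨C, c1, c2, c3, c4⟩

theorem lt_of_isGeometric {d : ℕ} {ε C : ℝ} (hε : 0 < ε) {l : Fin d → ℝ} (hl : IsGeometric ε l)
    (h0 : ∀ i : Fin d, (i : ℕ) = 0 → C < l i) : ∀ (k : ℕ) (hk : k < d), C < l ⟨k, hk⟩ := by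
  intro k
  induction k with
  | zero => exact fun hk => h0 _ rfl
  | succ k ih =>
    intro hk
    refine (ih (by lia)).trans_le (le_trans ?_ (hl.2 ⟨k, by lia⟩ ⟨k + 1, hk⟩ rfl))
    conv_lhs => rw [← Real.rpow_one (l _)]
    exact Real.rpow_le_rpow_of_exponent_le (hl.1 _).le (by linarith)

/-- Raising l^(1+2ε) to the power -ε/4 produces the extra factor l^(-ε²/2) ≤ 1/2. The densities of
all scales thus sum to a bound independent of d. -/
theorem rpow_le_of_isGeometric {d : ℕ} {ε C : ℝ} (hε : 0 < ε) (hC : 1 ≤ C)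
    (hC2 : 2 ≤ C ^ (ε ^ 2 / 2)) {l : Fin d → ℝ} (hl : IsGeometric ε l)
    (h0 : ∀ i : Fin d, (i : ℕ) = 0 → C < l i) :
    ∀ (k : ℕ) (hk : k < d), l ⟨k, hk⟩ ^ (-(ε / 4)) ≤ C ^ (-(ε / 4)) * (1 / 2) ^ k := by
  intro k
  induction k with
  | zero =>
    intro hk
    rw [pow_zero, mul_one]
    exact Real.rpow_le_rpow_of_nonpos (by linarith) (h0 _ rfl).le (by linarith)
  | succ k ih =>
    intro hk
    have hk' : k < d := by lia
    have h1 := hl.2 ⟨k, hk'⟩ ⟨k + 1, hk⟩ rfl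
    have h2 := lt_of_isGeometric hε hl h0 k hk'
    have hpos : 0 < l ⟨k, hk'⟩ := by linarith
    have h3 : (2 : ℝ) ≤ l ⟨k, hk'⟩ ^ (ε ^ 2 / 2) :=
      hC2.trans (Real.rpow_le_rpow (by linarith) h2.le (by positivity))
    calc l ⟨k + 1, hk⟩ ^ (-(ε / 4)) ≤ (l ⟨k, hk'⟩ ^ (1 + 2 * ε)) ^ (-(ε / 4)) :=
          Real.rpow_le_rpow_of_nonpos (by positivity) h1 (by linarith)
      _ = l ⟨k, hk'⟩ ^ (-(ε / 4)) * (l ⟨k, hk'⟩ ^ (ε ^ 2 / 2))⁻¹ := by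
        rw [← Real.rpow_mul hpos.le, ← Real.rpow_neg hpos.le, ← Real.rpow_add hpos]
        congr 1
        ring
      _ ≤ (C ^ (-(ε / 4)) * (1 / 2) ^ k) * (2 : ℝ)⁻¹ := by
        gcongr
        exact ih hk'
      _ = C ^ (-(ε / 4)) * (1 / 2) ^ (k + 1) := by
        rw [pow_succ]
        ring

theorem exists_isLatticeGraded {N d : ℕ} {l : Fin d → ℝ} {ε C : ℝ} {E E₀ : Set R3}
    {F : Fin d → Set R3} (hE : IsGraded N l ε⁻¹ ε E E₀ F) (hε : 0 < ε) (hε₀ : ε < 1 / 10 ^ 10)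
    (hC : 10 ^ 11 ≤ C) (hC1 : C ^ (-(ε / 4)) ≤ 1 / 8) (hC2 : 2 ≤ C ^ (ε ^ 2 / 2))
    (hC3 : 120000 * N * C ^ (-(ε / 4)) ≤ 1 / 4000)
    (h0 : ∀ i : Fin d, (i : ℕ) = 0 → C < l i) (A : Set Z3) :
    ∃ (c : Fin d → ℕ → Fin N → R3) (c₀ : ℕ → Z3), IsLatticeGraded ε l c c₀ {i | (F i ∩ toR3 '' A).Nonempty}
      {x : Z3 | x ∈ A ∧ toR3 x ∈ E} := by
  obtain ⟨c₀, hc₀, hsep₀⟩ := hE.unitScattered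
  choose c hc hsep using hE.scattered
  have hC0 : 1 ≤ C := le_trans (by norm_num) hC
  have hpow := rpow_le_of_isGeometric hε hC0 hC2 hE.geometric h0
  have hlt := lt_of_isGeometric hε hE.geometric h0
  have hCpos : 0 ≤ C ^ (-(ε / 4)) := by positivity
  refine ⟨c, c₀, hε, hε₀, fun i => hC.trans (hlt i i.2).le, fun i => ?_, ?_, ?_, ?_, ?_⟩
  · refine (hpow i i.2).trans (le_trans ?_ hC1)
    exact mul_le_of_le_one_right hCpos (pow_le_one₀ (by norm_num) (by norm_num))
  · calc ∑ i, 60000 * N * l i ^ (-(ε / 4))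
        ≤ ∑ i : Fin d, 60000 * N * (C ^ (-(ε / 4)) * (1 / 2) ^ (i : ℕ)) := by
          refine sum_le_sum fun i _ => ?_
          have := hpow i i.2
          gcongr
      _ = 60000 * N * C ^ (-(ε / 4)) * ∑ i ∈ range d, (1 / 2 : ℝ) ^ i := by
          rw [Fin.sum_univ_eq_sum_range (fun i => 60000 * N * (C ^ (-(ε / 4)) * (1 / 2 : ℝ) ^ i)),
            mul_sum]
          exact sum_congr rfl fun _ _ => by ring
      _ ≤ 60000 * N * C ^ (-(ε / 4)) * 2 := by
          gcongr
          exact sum_geometric_two_le d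
      _ ≤ 1 / 4000 := by linarith
  · intro i t j j' hj
    exact (hsep i t j j' hj).trans (setDist_ball_le _ _ (by linarith [hE.geometric.1 i]))
  · intro j j' hj
    exact (hsep₀ j j' hj).trans (setDist_ball_le _ _ one_pos)
  · rintro x ⟨hxA, hxE⟩
    rw [hE.eq_union] at hxE
    rcases hxE with h | h
    · rw [hc₀, Set.mem_iUnion] at h
      obtain ⟨j, hj⟩ := h
      exact Or.inl ⟨j, eq_of_dist_toR3_lt_one hj⟩
    · obtain ⟨i, hi⟩ := Set.mem_iUnion.1 h
      refine Or.inr ⟨i, ⟨toR3 x, hi, x, hxA, rfl⟩, ?_⟩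
      rw [hc i] at hi
      simp only [Set.mem_iUnion] at hi
      obtain ⟨j, t, hjt⟩ := hi
      exact ⟨t, j, hjt⟩

/-- The constant governing the decay rate in the unique continuation principle. -/
noncomputable def decayRate (K : ℝ) : ℝ := 20 * Real.log ((|K| + 12) * 2 ^ 3000) + 1

theorem one_le_growthBase (K : ℝ) : 1 ≤ (|K| + 12) * 2 ^ 3000 :=
  one_le_mul_of_one_le_of_one_le (by linarith [abs_nonneg K]) (one_le_pow₀ (by norm_num))

theorem decayRate_pos (K : ℝ) : 0 < decayRate K := by
  have := Real.log_nonneg (one_le_growthBase K)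
  rw [decayRate]
  linarith

/-- Too few exceptional points would give |u 0| ≤ exp(-C₂ n³) |u 0| B^(20R³) < |u 0|, where B = (|K|
+ 12) 2^3000. Normality enters through l^(1+ε) ≤ (4n)^((1-ε)(1+ε)) ≤ 4n. -/
theorem ncard_large_of_ne_zero {N d : ℕ} {l : Fin d → ℝ} {ε C K : ℝ} {E E₀ : Set R3}
    {F : Fin d → Set R3} (hE : IsGraded N l ε⁻¹ ε E E₀ F) (hε : 0 < ε) (hε₀ : ε < 1 / 10 ^ 10)
    (hC : 10 ^ 11 ≤ C) (hC1 : C ^ (-(ε / 4)) ≤ 1 / 8) (hC2 : 2 ≤ C ^ (ε ^ 2 / 2))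
    (hC3 : 120000 * N * C ^ (-(ε / 4)) ≤ 1 / 4000)
    (h0 : ∀ i : Fin d, (i : ℕ) = 0 → C < l i) {n : ℕ} (hn : C < n) {u V : Z3 → ℝ}
    (heq : ∀ a ∈ cube n 0, laplacian u a = V a * u a) (hV : ∀ a ∈ cube n 0, |V a| ≤ K)
    (hnormal : IsNormalIn l E₀ F 1 (2 * ε) (toR3 '' cube n 0)) (hu : u 0 ≠ 0) :
    (n : ℝ) ^ 2 / 10 ^ 21 ≤
      (Set.ncard ({a ∈ cube n 0 | Real.exp (-decayRate K * (n : ℝ) ^ 3) * |u 0| ≤ |u a|}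
          \ {a | toR3 a ∈ E}) : ℝ) := by
  set S := {a ∈ cube n 0 | Real.exp (-decayRate K * (n : ℝ) ^ 3) * |u 0| ≤ |u a|}
          \ {a | toR3 a ∈ E} with hS
  have hSfin : S.Finite := (finite_cube n).subset fun x hx => hx.1.1
  set X := hSfin.toFinset with hX
  rw [Set.ncard_eq_toFinset_card S hSfin]
  obtain ⟨c, c₀, hlat⟩ := exists_isLatticeGraded hE hε hε₀ hC hC1 hC2 hC3 h0 (cube n 0)
  have hn11 : 10 ^ 11 < n := by
    have : (10 : ℝ) ^ 11 < n := hC.trans_lt hn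
    exact_mod_cast this
  -- The cube of radius 4R must fit in the given one; n ≤ 8R and 200 · 10^16 · 64 < 10^21 account
  -- for the final constant.
  obtain ⟨R, hR⟩ : ∃ R, R = n / 4 := ⟨_, rfl⟩
  have hbox : ∀ x ∈ box 0 (4 * R), x ∈ cube n 0 := by
    intro x hx
    rw [mem_cube_iff]
    exact box_mono (by lia) hx
  by_contra hcon
  push Not at hcon
  have hfew : 200 * (10 ^ 8) ^ 2 * #X < R ^ 2 := by
    have h1 : (n : ℝ) ≤ 8 * R := by exact_mod_cast (by lia : n ≤ 8 * R)
    have h2 : (#X : ℝ) * 10 ^ 21 < n ^ 2 := by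
      rwa [lt_div_iff₀ (by norm_num)] at hcon
    have h3 : (200 * (10 ^ 8) ^ 2 * #X : ℝ) < R ^ 2 := by
      have : (n : ℝ) ^ 2 ≤ (8 * R) ^ 2 := by gcongr
      nlinarith
    exact_mod_cast h3
  have hscale : ∀ i ∈ {i | (F i ∩ toR3 '' cube n 0).Nonempty},
      l i ^ (1 + ε) ≤ 10000 * (2 * R + 1 : ℕ) := by
    intro i hi
    have h1 := hnormal.2 i hi
    have hn1 : (1 : ℝ) ≤ 4 * n := by
      have : (10 : ℝ) ^ 11 < n := hC.trans_lt hn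
      linarith
    have hε1 : ε < 1 := hε₀.trans (by norm_num)
    have h2 : l i ≤ (4 * n : ℝ) ^ (1 - ε) := by
      refine h1.trans ?_
      rw [mul_div_cancel_left₀ ε (by norm_num)]
      exact Real.rpow_le_rpow Metric.diam_nonneg (diam_cube_le n) (by linarith)
    calc l i ^ (1 + ε) ≤ ((4 * n : ℝ) ^ (1 - ε)) ^ (1 + ε) :=
          Real.rpow_le_rpow (by linarith [hE.geometric.1 i]) h2 (by linarith)
      _ = (4 * n : ℝ) ^ ((1 - ε) * (1 + ε)) := (Real.rpow_mul (by linarith) _ _).symm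
      _ ≤ (4 * n : ℝ) ^ (1 : ℝ) :=
          Real.rpow_le_rpow_of_exponent_le hn1 (by nlinarith)
      _ = 4 * n := Real.rpow_one _
      _ ≤ 10000 * (2 * R + 1 : ℕ) := by exact_mod_cast (by lia : 4 * n ≤ 10000 * (2 * R + 1))
  have hstep : IsStep (cyc 0 1 0 0) := by
    refine ⟨fun h => ?_, fun t => ?_⟩
    · have := congrFun h 0
      simp at this
    · rcases fin3_cases 0 t with rfl | rfl | rfl
      · rw [cyc_zero]
        norm_num
      · rw [cyc_one]
        norm_num
      · rw [cyc_two]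
        norm_num
  have hmain := abs_zero_le_of_few_large 10000 (10 ^ 8) (by norm_num) (by norm_num) u V |K|
    (Real.exp (-decayRate K * (n : ℝ) ^ 3) * |u 0|) (abs_nonneg K) (by positivity)
    {x : Z3 | x ∈ cube n 0 ∧ toR3 x ∈ E} X R (by lia) (fun x hx => heq x (hbox x hx))
    (fun x hx => (hV x (hbox x hx)).trans (le_abs_self K)) (by
      intro x hx
      by_cases h1 : |u x| ≤ Real.exp (-decayRate K * (n : ℝ) ^ 3) * |u 0|
      · exact Or.inl h1
      · by_cases h2 : toR3 x ∈ E
        · exact Or.inr (Or.inl ⟨hbox x hx, h2⟩)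
        · refine Or.inr (Or.inr (hSfin.mem_toFinset.2 ⟨⟨hbox x hx, ?_⟩, h2⟩))
          exact (not_le.1 h1).le)
    (fun y _ => hlat.segCount_not_thinAround R _ _ _ hstep hscale) hfew
  have hB := one_le_growthBase K
  have hlog := Real.log_nonneg hB
  have hpow : ((|K| + 12) * 2 ^ 3000) ^ (20 * R ^ 3) ≤
      Real.exp (20 * Real.log ((|K| + 12) * 2 ^ 3000) * (n : ℝ) ^ 3) := by
    calc ((|K| + 12) * 2 ^ 3000) ^ (20 * R ^ 3) ≤ ((|K| + 12) * 2 ^ 3000) ^ (20 * n ^ 3) := by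
          refine pow_le_pow_right₀ hB ?_
          have : R ^ 3 ≤ n ^ 3 := Nat.pow_le_pow_left (by lia) 3
          lia
      _ = Real.exp (20 * Real.log ((|K| + 12) * 2 ^ 3000) * (n : ℝ) ^ 3) := by
          rw [← Real.rpow_natCast, Real.rpow_def_of_pos (by linarith)]
          congr 1
          push_cast
          ring
  have hu0 : 0 < |u 0| := abs_pos.2 hu
  have hlt : Real.exp (-decayRate K * (n : ℝ) ^ 3) * |u 0| *
      ((|K| + 12) * 2 ^ 3000) ^ (20 * R ^ 3) < |u 0| := by
    calc _ ≤ Real.exp (-decayRate K * (n : ℝ) ^ 3) * |u 0| *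
          Real.exp (20 * Real.log ((|K| + 12) * 2 ^ 3000) * (n : ℝ) ^ 3) := by gcongr
      _ = Real.exp (-(n : ℝ) ^ 3) * |u 0| := by
          rw [mul_right_comm, ← Real.exp_add]
          congr 2
          rw [decayRate]
          ring
      _ < 1 * |u 0| := by
          refine mul_lt_mul_of_pos_right ?_ hu0
          rw [Real.exp_lt_one_iff, neg_lt_zero]
          have : 0 < n := by lia
          positivity
      _ = |u 0| := one_mul _
  linarith

/-- If u 0 = 0 the threshold vanishes and all points of the cube outside `E` count. Their number is
bounded below by applying the nonzero case to the constant solution 1 with zero potential. -/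
theorem ncard_large {N d : ℕ} {l : Fin d → ℝ} {ε C K : ℝ} {E E₀ : Set R3}
    {F : Fin d → Set R3} (hE : IsGraded N l ε⁻¹ ε E E₀ F) (hε : 0 < ε) (hε₀ : ε < 1 / 10 ^ 10)
    (hC : 10 ^ 11 ≤ C) (hC1 : C ^ (-(ε / 4)) ≤ 1 / 8) (hC2 : 2 ≤ C ^ (ε ^ 2 / 2))
    (hC3 : 120000 * N * C ^ (-(ε / 4)) ≤ 1 / 4000)
    (h0 : ∀ i : Fin d, (i : ℕ) = 0 → C < l i) (hK : 0 < K) {n : ℕ} (hn : C < n) {u V : Z3 → ℝ}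
    (heq : ∀ a ∈ cube n 0, laplacian u a = V a * u a) (hV : ∀ a ∈ cube n 0, |V a| ≤ K)
    (hnormal : IsNormalIn l E₀ F 1 (2 * ε) (toR3 '' cube n 0)) :
    (n : ℝ) ^ 2 / 10 ^ 21 ≤
      (Set.ncard ({a ∈ cube n 0 | Real.exp (-decayRate K * (n : ℝ) ^ 3) * |u 0| ≤ |u a|}
          \ {a | toR3 a ∈ E}) : ℝ) := by
  by_cases hu : u 0 = 0
  · have h1 := ncard_large_of_ne_zero (u := fun _ => 1) (V := fun _ => 0) hE hε hε₀ hC hC1 hC2 hC3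
      h0 hn (fun a _ => by simp [laplacian]; norm_num) (fun a _ => by simpa using hK.le) hnormal
      one_ne_zero
    refine h1.trans ?_
    norm_cast
    refine Set.ncard_le_ncard ?_ ((finite_cube n).subset fun x hx => hx.1.1)
    rintro x ⟨⟨hx, -⟩, hxE⟩
    exact ⟨⟨hx, by simp [hu]⟩, hxE⟩
  · exact ncard_large_of_ne_zero hE hε hε₀ hC hC1 hC2 hC3 h0 hn heq hV hnormal hu

end DiscreteUCP

open DiscreteUCP in
theorem theorem5p1 :
    ∃ C₃ : ℝ, 0 < C₃ ∧ ∃ ε₀ : ℝ, 0 < ε₀ ∧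
    ∃ (C₂ : ℝ → ℝ) (Cεn : ℝ → ℕ → ℝ), (∀ K, 0 < C₂ K) ∧ (∀ ε N, 0 < Cεn ε N) ∧
    ∀ (K : ℝ) (N : ℕ) (ε : ℝ), 0 < K → 0 < N → 0 < ε → ε < ε₀ →
    ∀ n : ℕ, Cεn ε N < (n : ℝ) →
    ∀ u V : Z3 → ℝ,
      (∀ a ∈ cube n 0, laplacian u a = V a * u a) →
      (∀ a ∈ cube n 0, |V a| ≤ K) →
    ∀ (d : ℕ) (l : Fin d → ℝ) (E E₀ : Set R3) (F : Fin d → Set R3),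
      IsGraded N l ε⁻¹ ε E E₀ F →
      (∀ i : Fin d, (i : ℕ) = 0 → Cεn ε N < l i) →
      IsNormalIn l E₀ F 1 (2 * ε) (toR3 '' cube n 0) →
      C₃ * (n : ℝ) ^ 2 / Real.logb 2 n ≤
        (Set.ncard ({a ∈ cube n 0 | Real.exp (-C₂ K * (n : ℝ) ^ 3) * |u 0| ≤ |u a|}
          \ {a | toR3 a ∈ E}) : ℝ) := by
  have hex : ∀ (ε : ℝ) (N : ℕ), ∃ C : ℝ, 10 ^ 11 ≤ C ∧ (0 < ε → C ^ (-(ε / 4)) ≤ 1 / 8 ∧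
      2 ≤ C ^ (ε ^ 2 / 2) ∧ 120000 * N * C ^ (-(ε / 4)) ≤ 1 / 4000) := by
    intro ε N
    by_cases hε : 0 < ε
    · obtain ⟨C, h1, h2⟩ := exists_scale_bound ε hε N
      exact ⟨C, h1, fun _ => h2⟩
    -- A default value, so that the constant is defined and positive for every real ε.
    · exact ⟨10 ^ 11, le_rfl, fun h => absurd h hε⟩
  choose C hC hC' using hex
  refine ⟨1 / 10 ^ 21, by norm_num, 1 / 10 ^ 10, by norm_num, decayRate, C, decayRate_pos,
    fun ε N => lt_of_lt_of_le (by norm_num) (hC ε N), ?_⟩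
  intro K N ε hK _ hε hε₀ n hn u V heq hV d l E E₀ F hE h0 hnormal
  obtain ⟨h1, h2, h3⟩ := hC' ε N hε
  refine le_trans ?_ (ncard_large hE hε hε₀ (hC ε N) h1 h2 h3 h0 hK hn heq hV hnormal)
  have hn2 : (2 : ℝ) ≤ n := by
    have := (hC ε N).trans_lt hn
    linarith
  -- As n ≥ 2, dividing by the logarithm only weakens the bound already proved.
  have hlog : 1 ≤ Real.logb 2 n := by
    rw [Real.le_logb_iff_rpow_le one_lt_two (by linarith), Real.rpow_one]
    exact hn2
  rw [one_div_mul_eq_div]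
  exact div_le_self (by positivity) hlog
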